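/- Let $n\ge 1$, $1\le K\le n$, let $\mathbf t=(t_0,\dots,t_K)$ be integers with $0=t_0<t_1<\dots<t_K=n$, put $n_k=t_k-t_{k-1}$, and let $\sigma$ be a permutation of $\{1,\dots,n\}$. Let $\mathcal C(\mathbf t,\sigma)=(\mathcal C_1,\dots,\mathcal C_K)$ with $\mathcal C_k=\{\sigma(t_{k-1}+1),\dots,\sigma(t_k)\}$. Fix $\lambda>0$. For $\boldsymbol x\in\mathbb R^n$ let $\widehat{\boldsymbol B}(\boldsymbol x)$ be the (unique) minimizer over $\boldsymbol B\in\mathbb R^n$ of $$\tfrac12\|\boldsymbol B-\boldsymbol x\|_2^2+\lambda\sum_{1\le i<i'\le n}|B_{i'}-B_i| .$$ The clustering given by $\widehat{\boldsymbol B}$ is the family of sets $\{i:\widehat B_i=b_k\}$, where $b_1>b_2>\cdots$ are the distinct values among the $\widehat B_i$. Let $\boldsymbol X\sim\mathcal N(\boldsymbol\mu,\boldsymbol\Sigma)$ in $\mathbb R^n$ with $\boldsymbol\Sigma$ invertible, and let $\boldsymbol\eta\in\mathbb R^n$ be a fixed non-zero vector (it may depend on $(\mathbf t,\sigma)$ only)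 with $\boldsymbol\eta^\top\boldsymbol\mu=0$. The $p$-value is defined as follows. Let $\mathbf P_\sigma\boldsymbol x=(x_{\sigma(1)},\dots,x_{\sigma(n)})^\top$. Let $\mathbf M\in\mathbb R^{2(n-1)\times n}$ and $\mathbf m\in\mathbb R^{2(n-1)}$ be such that the system $\mathbf M\boldsymbol y\le\lambda\mathbf m$ consists of the inequalities - $y_{i+1}-y_i\le 0$ for $1\le i\le n-1$; - $\frac1{n_{k+1}}\sum_{i=1}^{n_{k+1}}y_{t_k+i}-\frac1{n_k}\sum_{i=1}^{n_k}y_{t_{k-1}+i}\le-\lambda(t_{k+1}-t_{k-1})$ for $1\le k\le K-1$; - $\frac1\ell\sum_{i=1}^{\ell}y_{t_{k-1}+i}-\frac1{n_k}\sum_{i=1}^{n_k}y_{t_{k-1}+i}\le\lambda(n_k-\ell)$ for $1\le k\le K$, $1\le\ell\le n_k-1$, where each left-hand side is a row of $\mathbf M\boldsymbol y$ and each right-hand side is the corresponding entry of $\lambda\mathbf m$. Put $\boldsymbol c=\boldsymbol\Sigma\boldsymbol\eta(\boldsymbol\eta^\top\boldsymbol\Sigma\boldsymbol\eta)^{-1}$,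 $\boldsymbol Z(\boldsymbol x)=(\boldsymbol I_n-\boldsymbol c\boldsymbol\eta^\top)\boldsymbol x$, and, with $\max\emptyset=-\infty$ and $\min\emptyset=+\infty$, $$\mathcal V^-(\boldsymbol z)=\max_{l:(\mathbf M\mathbf P_\sigma\boldsymbol c)_l<0}\frac{\lambda m_l-(\mathbf M\mathbf P_\sigma\boldsymbol z)_l}{(\mathbf M\mathbf P_\sigma\boldsymbol c)_l},\qquad \mathcal V^+(\boldsymbol z)=\min_{l:(\mathbf M\mathbf P_\sigma\boldsymbol c)_l>0}\frac{\lambda m_l-(\mathbf M\mathbf P_\sigma\boldsymbol z)_l}{(\mathbf M\mathbf P_\sigma\boldsymbol c)_l}.$$ Let $F^{[a,b]}_{\nu,\tau^2}$ be the cumulative distribution function of $\mathcal N(\nu,\tau^2)$ truncated to $[a,b]$, and let $$T(\boldsymbol x)=F^{[\mathcal V^-(\boldsymbol Z(\boldsymbol x)),\,\mathcal V^+(\boldsymbol Z(\boldsymbol x))]}_{0,\;\boldsymbol\eta^\top\boldsymbol\Sigma\boldsymbol\eta}(\boldsymbol\eta^\top\boldsymbol x),\qquad \mathrm{pval}(\boldsymbol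 x,\mathbf t,\sigma)=2\min\bigl(T(\boldsymbol x),1-T(\boldsymbol x)\bigr).$$ Assume that the event $$E_{\mathbf t,\sigma}=\Bigl\{\mathcal C(\mathbf t,\sigma)\text{ is the clustering given by }\widehat{\boldsymbol B}(\boldsymbol X),\ X_{\sigma(1)}\ge X_{\sigma(2)}\ge\dots\ge X_{\sigma(n)}\Bigr\}$$ has non-zero probability. Then, conditionally to $E_{\mathbf t,\sigma}$, $\mathrm{pval}(\boldsymbol X,\mathbf t,\sigma)$ is uniformly distributed on $[0,1]$; in particular $$\mathbb P\bigl(\mathrm{pval}(\boldsymbol X,\mathbf t,\sigma)\le u\mid E_{\mathbf t,\sigma}\bigr)=u\qquad\text{for all }u\in[0,1].$$ -/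

import Mathlib

open MeasureTheory ProbabilityTheory

namespace ConvexClustering

noncomputable section

/-! ### The one-dimensional convex clustering problem -/

/-- The criterion `½ ‖B - x‖² + lam * ∑_{i < i'} |B i' - B i|`. -/
def criterion {n : ℕ} (lam : ℝ) (x B : EuclideanSpace ℝ (Fin n)) : ℝ :=
  1 / 2 * ‖B - x‖ ^ 2 + lam * ∑ i : Fin n, ∑ i' ∈ Finset.Ioi i, |B i' - B i|

/-- `B` belongs to the argmin of the criterion. -/
def IsSolution {n : ℕ} (lam : ℝ) (x B : EuclideanSpace ℝ (Fin n)) : Prop :=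
  ∀ B' : EuclideanSpace ℝ (Fin n), criterion lam x B ≤ criterion lam x B'

/-- The solution of the convex clustering problem with data `x`
(it exists and is unique, see `existsUnique_isSolution`). -/
def bHat {n : ℕ} (lam : ℝ) (x : EuclideanSpace ℝ (Fin n)) : EuclideanSpace ℝ (Fin n) :=
  Classical.epsilon (IsSolution lam x)

theorem exists_isSolution {n : ℕ} {lam : ℝ} (hlam : 0 < lam) (x : EuclideanSpace ℝ (Fin n)) :
    ∃ B, IsSolution lam x B := by
  have hcont : Continuous (criterion lam x) := by
    unfold criterion
    fun_prop
  refine hcont.exists_forall_le ?_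
  have h1 : Filter.Tendsto (fun B : EuclideanSpace ℝ (Fin n) => 1 / 2 * ‖B - x‖ ^ 2)
      (Filter.cocompact _) Filter.atTop := by
    refine Filter.Tendsto.const_mul_atTop (by norm_num) ?_
    refine (Filter.tendsto_pow_atTop two_ne_zero).comp ?_
    simpa [dist_eq_norm] using tendsto_dist_right_cocompact_atTop x
  refine Filter.tendsto_atTop_mono (fun B => ?_) h1
  have h2 : 0 ≤ lam * ∑ i : Fin n, ∑ i' ∈ Finset.Ioi i, |B i' - B i| :=
    mul_nonneg hlam.le (Finset.sum_nonneg fun i _ => Finset.sum_nonneg fun i' _ => abs_nonneg _)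
  unfold criterion
  linarith

theorem isSolution_unique {n : ℕ} {lam : ℝ} (hlam : 0 < lam) {x B C : EuclideanSpace ℝ (Fin n)}
    (hB : IsSolution lam x B) (hC : IsSolution lam x C) : B = C := by
  have hM := hB ((1 / 2 : ℝ) • (B + C))
  have hBC : criterion lam x B ≤ criterion lam x C := hB C
  have hCB : criterion lam x C ≤ criterion lam x B := hC B
  have hpar : ‖(1 / 2 : ℝ) • (B + C) - x‖ ^ 2 =
      1 / 2 * ‖B - x‖ ^ 2 + 1 / 2 * ‖C - x‖ ^ 2 - 1 / 4 * ‖B - C‖ ^ 2 := by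
    simp only [EuclideanSpace.norm_sq_eq, Real.norm_eq_abs, sq_abs, Finset.mul_sum,
      ← Finset.sum_add_distrib, ← Finset.sum_sub_distrib]
    refine Finset.sum_congr rfl fun i _ => ?_
    simp only [PiLp.sub_apply, PiLp.add_apply, PiLp.smul_apply, smul_eq_mul]
    ring
  have habs : ∑ i : Fin n, ∑ i' ∈ Finset.Ioi i,
        |((1 / 2 : ℝ) • (B + C)) i' - ((1 / 2 : ℝ) • (B + C)) i| ≤
      1 / 2 * ∑ i : Fin n, ∑ i' ∈ Finset.Ioi i, |B i' - B i| +
      1 / 2 * ∑ i : Fin n, ∑ i' ∈ Finset.Ioi i, |C i' - C i| := by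
    simp only [Finset.mul_sum, ← Finset.sum_add_distrib]
    refine Finset.sum_le_sum fun i _ => Finset.sum_le_sum fun i' _ => ?_
    have e : ((1 / 2 : ℝ) • (B + C)) i' - ((1 / 2 : ℝ) • (B + C)) i =
        1 / 2 * (B i' - B i) + 1 / 2 * (C i' - C i) := by
      simp only [PiLp.add_apply, PiLp.smul_apply, smul_eq_mul]
      ring
    rw [e]
    refine (abs_add_le _ _).trans (le_of_eq ?_)
    rw [abs_mul, abs_mul, abs_of_pos (by norm_num : (0 : ℝ) < 1 / 2)]
  have habs' := mul_le_mul_of_nonneg_left habs hlam.le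
  unfold criterion at hM hBC hCB
  rw [hpar] at hM
  have h0 : ‖B - C‖ ^ 2 ≤ 0 := by nlinarith
  have h1 : ‖B - C‖ = 0 := by nlinarith [norm_nonneg (B - C)]
  exact sub_eq_zero.mp (norm_eq_zero.mp h1)

theorem existsUnique_isSolution {n : ℕ} {lam : ℝ} (hlam : 0 < lam)
    (x : EuclideanSpace ℝ (Fin n)) : ∃! B, IsSolution lam x B := by
  obtain ⟨B, hB⟩ := exists_isSolution hlam x
  exact ⟨B, hB, fun C hC => isSolution_unique hlam hC hB⟩

theorem bHat_isSolution {n : ℕ} {lam : ℝ} (hlam : 0 < lam) (x : EuclideanSpace ℝ (Fin n)) :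
    IsSolution lam x (bHat lam x) :=
  Classical.epsilon_spec (exists_isSolution hlam x)

/-! ### Clusterings

Observations are indexed by `Fin n` and clusters by `Fin K`, both from `0`: the cluster `k : Fin K`
occupies the positions `j` with `t k.castSucc ≤ j < t k.succ` in the sorted data. -/

/-- `C` is the clustering associated with `B`: if `b 0 > b 1 > ⋯ > b (K - 1)` are the distinct
values of `B`, then `C k = {i | B i = b k}`. -/
def IsClusteringOf {n K : ℕ} (B : Fin n → ℝ) (C : Fin K → Finset (Fin n)) : Prop :=
  ∃ b : Fin K → ℝ, StrictAnti b ∧ Set.range b = Set.range B ∧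
    ∀ (k : Fin K) (i : Fin n), i ∈ C k ↔ B i = b k

/-- The sequences `0 = t 0 < t 1 < ⋯ < t K = n` of cluster right-limits. -/
def rightLimits (K n : ℕ) : Set (Fin (K + 1) → ℕ) :=
  {t | t 0 = 0 ∧ StrictMono t ∧ t (Fin.last K) = n}

/-- The cardinality of the cluster `k`. -/
def clusterSize {K : ℕ} (t : Fin (K + 1) → ℕ) (k : Fin K) : ℕ :=
  t k.succ - t k.castSucc

/-- The clustering associated with right-limits `t` and a permutation `σ`. -/
def segClustering {n K : ℕ} (t : Fin (K + 1) → ℕ) (σ : Equiv.Perm (Fin n)) (k : Fin K) :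
    Finset (Fin n) :=
  (Finset.univ.filter fun j : Fin n => t k.castSucc ≤ (j : ℕ) ∧ (j : ℕ) < t k.succ).image σ

/-- The set of data vectors `x` for which the convex clustering with parameter `lam` yields the
clustering associated with `(t, σ)`, and `x (σ 0) ≥ x (σ 1) ≥ ⋯ ≥ x (σ (n - 1))`. -/
def selectionSet {n K : ℕ} (lam : ℝ) (t : Fin (K + 1) → ℕ) (σ : Equiv.Perm (Fin n)) :
    Set (EuclideanSpace ℝ (Fin n)) :=
  {x | IsClusteringOf (bHat lam x).ofLp (segClustering t σ) ∧ Antitone fun j => x (σ j)}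

/-! ### The polyhedron `M(t) P_σ x ≤ lam m(t)` -/

/-- The indices of the `(n - 1) + (K - 1) + (n - K)` rows. In the last block, the row `⟨k, l⟩`
is the one of the cluster `k` and the length `l + 1`. -/
abbrev RowIndex {K : ℕ} (n : ℕ) (t : Fin (K + 1) → ℕ) : Type :=
  Fin (n - 1) ⊕ Fin (K - 1) ⊕ (Σ k : Fin K, Fin (clusterSize t k - 1))

/-- `(M₁ y)_i = y (i + 1) - y i`. -/
def M₁ (n : ℕ) : Matrix (Fin (n - 1)) (Fin n) ℝ :=
  Matrix.of fun i j =>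
    if (j : ℕ) = i then -1 else if (j : ℕ) = (i : ℕ) + 1 then 1 else 0

/-- `(M₂ y)_k` is the mean of `y` over the cluster `k + 1` minus its mean over the cluster `k`. -/
def M₂ {K : ℕ} (n : ℕ) (t : Fin (K + 1) → ℕ) : Matrix (Fin (K - 1)) (Fin n) ℝ :=
  Matrix.of fun k j =>
    let t₀ := t ⟨k, by omega⟩
    let t₁ := t ⟨k + 1, by omega⟩
    let t₂ := t ⟨k + 2, by omega⟩
    if t₀ ≤ (j : ℕ) ∧ (j : ℕ) < t₁ then -(1 / ((t₁ : ℝ) - t₀))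
    else if t₁ ≤ (j : ℕ) ∧ (j : ℕ) < t₂ then 1 / ((t₂ : ℝ) - t₁)
    else 0

def m₂ {K : ℕ} (t : Fin (K + 1) → ℕ) (k : Fin (K - 1)) : ℝ :=
  -((t ⟨k + 2, by omega⟩ : ℝ) - t ⟨k, by omega⟩)

/-- `(M₃ y)_⟨k, l⟩` is the mean of `y` over the first `l + 1` positions of the cluster `k` minus
its mean over the whole cluster. -/
def M₃ {K : ℕ} (n : ℕ) (t : Fin (K + 1) → ℕ) :
    Matrix (Σ k : Fin K, Fin (clusterSize t k - 1)) (Fin n) ℝ :=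
  Matrix.of fun r j =>
    (if t r.1.castSucc ≤ (j : ℕ) ∧ (j : ℕ) < t r.1.castSucc + (r.2 + 1)
      then 1 / ((r.2 : ℝ) + 1) else 0) -
    (if t r.1.castSucc ≤ (j : ℕ) ∧ (j : ℕ) < t r.1.succ
      then 1 / (clusterSize t r.1 : ℝ) else 0)

def m₃ {K : ℕ} (t : Fin (K + 1) → ℕ) (r : Σ k : Fin K, Fin (clusterSize t k - 1)) : ℝ :=
  (clusterSize t r.1 : ℝ) - ((r.2 : ℝ) + 1)

def matM {K : ℕ} (n : ℕ) (t : Fin (K + 1) → ℕ) : Matrix (RowIndex n t) (Fin n) ℝ :=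
  Matrix.fromRows (M₁ n) (Matrix.fromRows (M₂ n t) (M₃ n t))

def vecM {K : ℕ} (n : ℕ) (t : Fin (K + 1) → ℕ) : RowIndex n t → ℝ :=
  Sum.elim (fun _ => 0) (Sum.elim (m₂ t) (m₃ t))

/-! ### The truncated-Gaussian p-value -/

/-- The cumulative distribution function of the Gaussian distribution `N(ν, v)` truncated to the
interval `[a, b]`, that is, conditioned on `[a, b]`. -/
def truncGaussianCDF (ν : ℝ) (v : NNReal) (a b : EReal) (x : ℝ) : ℝ :=
  (cond (gaussianReal ν v) {y : ℝ | a ≤ (y : EReal) ∧ (y : EReal) ≤ b}).real (Set.Iic x)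

open scoped Matrix

variable {n K : ℕ}

/-- `c = Σ η (ηᵀ Σ η)⁻¹`, with `S` the covariance matrix `Σ`. -/
def cVec (S : Matrix (Fin n) (Fin n) ℝ) (η : Fin n → ℝ) : Fin n → ℝ :=
  (η ⬝ᵥ S *ᵥ η)⁻¹ • (S *ᵥ η)

/-- `Z(x) = (I - c ηᵀ) x`. -/
def zVec (S : Matrix (Fin n) (Fin n) ℝ) (η x : Fin n → ℝ) : Fin n → ℝ :=
  (1 - Matrix.vecMulVec (cVec S η) η) *ᵥ x

/-- `(M P_σ c)_r`. -/
def rowC (t : Fin (K + 1) → ℕ) (σ : Equiv.Perm (Fin n)) (S : Matrix (Fin n) (Fin n) ℝ)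
    (η : Fin n → ℝ) (r : RowIndex n t) : ℝ :=
  ((matM n t * σ.permMatrix ℝ) *ᵥ cVec S η) r

/-- `(lam m_r - (M P_σ z)_r) / (M P_σ c)_r`. -/
def rowRatio (lam : ℝ) (t : Fin (K + 1) → ℕ) (σ : Equiv.Perm (Fin n))
    (S : Matrix (Fin n) (Fin n) ℝ) (η z : Fin n → ℝ) (r : RowIndex n t) : ℝ :=
  (lam * vecM n t r - ((matM n t * σ.permMatrix ℝ) *ᵥ z) r) / rowC t σ S η r

/-- `V⁻(z)`: the maximum of the ratios over the rows with `(M P_σ c)_r < 0`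
(`-∞` if there is none). -/
def vMinus (lam : ℝ) (t : Fin (K + 1) → ℕ) (σ : Equiv.Perm (Fin n))
    (S : Matrix (Fin n) (Fin n) ℝ) (η z : Fin n → ℝ) : EReal :=
  ⨆ (r : RowIndex n t) (_ : rowC t σ S η r < 0), (rowRatio lam t σ S η z r : EReal)

/-- `V⁺(z)`: the minimum of the ratios over the rows with `(M P_σ c)_r > 0`
(`+∞` if there is none). -/
def vPlus (lam : ℝ) (t : Fin (K + 1) → ℕ) (σ : Equiv.Perm (Fin n))
    (S : Matrix (Fin n) (Fin n) ℝ) (η z : Fin n → ℝ) : EReal :=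
  ⨅ (r : RowIndex n t) (_ : 0 < rowC t σ S η r), (rowRatio lam t σ S η z r : EReal)

/-- The statistic `T(x, t, σ)`. -/
def tStat (lam : ℝ) (t : Fin (K + 1) → ℕ) (σ : Equiv.Perm (Fin n))
    (S : Matrix (Fin n) (Fin n) ℝ) (η x : Fin n → ℝ) : ℝ :=
  truncGaussianCDF 0 (η ⬝ᵥ S *ᵥ η).toNNReal
    (vMinus lam t σ S η (zVec S η x)) (vPlus lam t σ S η (zVec S η x)) (η ⬝ᵥ x)

/-- The two-sided p-value `2 min(T, 1 - T)`. -/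
def pval (lam : ℝ) (t : Fin (K + 1) → ℕ) (σ : Equiv.Perm (Fin n))
    (S : Matrix (Fin n) (Fin n) ℝ) (η x : Fin n → ℝ) : ℝ :=
  2 * min (tStat lam t σ S η x) (1 - tStat lam t σ S η x)

end

end ConvexClustering

/-! Two independent facts carry the theorem.

Optimization. The criterion is invariant under a simultaneous permutation of data and variable, and
for sorted data a minimizer may be sought among non-increasing vectors (rearrangement inequality).
There the penalty is linear, so the criterion is an explicit quadratic. A non-increasing `b` is then
optimal iff the partial sums of the gradient at `b` are non-negative and vanish at every strict drop
of `b` and at `n`. Vanishing at the block ends forces the value on each block to be its mean minus a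
shift (`clusterValue`). Strict decrease of these values and non-negativity inside the blocks are the
rows of `M₂` and `M₃`, so the selection event is the polyhedron with the `M₂` rows made strict
(`mem_selectionSet_iff_mem_polyhedron`). The two sets differ by null hyperplanes.

Probability. Write `x = Z(x) + (ηᵀx) c`. For fixed `Z = z`, membership in the polyhedron is a
condition on `z` alone together with `ηᵀx ∈ [V⁻(z), V⁺(z)]` (`mem_polyhedron_iff`). `Z(X)` and `ηᵀX`
are jointly Gaussian and uncorrelated, hence independent, so given `Z` and the event, `ηᵀX` is a
truncated centred Gaussian and `T` is its distribution function at itself. The p-value is therefore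
uniform on every fibre, and Fubini over `z` concludes (`measure_polyhedron_inter_pval_le`). -/

namespace ConvexClustering

/-! ### Probability integral transform -/

/-- The probability integral transform: if `F` is the distribution function of an atomless
probability measure, then `{F ≤ p}` has mass `p`. -/
theorem measure_cdf_le (ρ : Measure ℝ) [IsProbabilityMeasure ρ] [NullSingletonClass ρ] {p : ℝ}
    (h0 : 0 ≤ p) (h1 : p < 1) : ρ {x | ρ.real (Set.Iic x) ≤ p} = ENNReal.ofReal p := by
  have hF : (fun x => ρ.real (Set.Iic x)) = cdf ρ := by
    ext x; rw [cdf_eq_real]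
  -- The jump of the distribution function at `x` is the mass of `{x}`, which is zero.
  have hcont : Continuous (cdf ρ) := by
    rw [continuous_iff_continuousAt]
    intro x
    rw [(monotone_cdf ρ).continuousAt_iff_leftLim_eq_rightLim, StieltjesFunction.rightLim_eq]
    have h := (cdf ρ).measure_singleton x
    rw [measure_cdf, measure_singleton] at h
    have h2 := ENNReal.ofReal_eq_zero.1 h.symm
    have h3 := (monotone_cdf ρ).leftLim_le (le_refl x)
    linarith
  have hset : {x | ρ.real (Set.Iic x) ≤ p} = {x | cdf ρ x ≤ p} := by
    ext x; simp [cdf_eq_real]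
  rw [hset]
  -- The sublevel set is empty only if `p = 0`; otherwise it is a half-line `Iic x₀`, and the value
  -- at `x₀` is `p` by the intermediate value theorem.
  rcases Set.eq_empty_or_nonempty {x | cdf ρ x ≤ p} with he | hne
  · have hp : p = 0 := by
      by_contra hp
      have hp' : 0 < p := lt_of_le_of_ne h0 (Ne.symm hp)
      obtain ⟨x, hx⟩ := ((tendsto_cdf_atBot ρ).eventually_lt_const hp').exists
      have : x ∈ {x | cdf ρ x ≤ p} := hx.le
      rw [he] at this
      exact this
    rw [he, hp]; simp
  · obtain ⟨z, hz⟩ := ((tendsto_cdf_atTop ρ).eventually_const_lt h1).exists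
    have hbdd : BddAbove {x | cdf ρ x ≤ p} := by
      refine ⟨z, fun x hx => ?_⟩
      by_contra hlt
      exact absurd ((monotone_cdf ρ) (not_le.1 hlt).le) (not_le.2 (lt_of_le_of_lt hx hz))
    have hclosed : IsClosed {x | cdf ρ x ≤ p} := isClosed_le hcont continuous_const
    set x₀ := sSup {x | cdf ρ x ≤ p} with hx₀
    have hmem : cdf ρ x₀ ≤ p := hclosed.csSup_mem hne hbdd
    have hIic : {x | cdf ρ x ≤ p} = Set.Iic x₀ := by
      ext x
      exact ⟨fun hx => le_csSup hbdd hx, fun hx => (monotone_cdf ρ hx).trans hmem⟩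
    have hval : cdf ρ x₀ = p := by
      refine le_antisymm hmem ?_
      obtain ⟨y, hy⟩ := mem_range_of_exists_le_of_exists_ge hcont hne ⟨z, hz.le⟩
      have hyx : y ≤ x₀ := le_csSup hbdd hy.le
      rw [← hy]
      exact monotone_cdf ρ hyx
    rw [hIic, ← ofReal_cdf, hval]

/-- Squeezed between `{F ≤ q}` for `q < p` and `{F ≤ p}`. It gives the mass of the upper tail by
complement. -/
theorem measure_cdf_lt (ρ : Measure ℝ) [IsProbabilityMeasure ρ] [NullSingletonClass ρ] {p : ℝ}
    (h0 : 0 < p) (h1 : p ≤ 1) : ρ {x | ρ.real (Set.Iic x) < p} = ENNReal.ofReal p := by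
  refine le_antisymm ?_ ?_
  · rcases h1.lt_or_eq with h1 | rfl
    · rw [← measure_cdf_le ρ h0.le h1]
      exact measure_mono fun x hx => le_of_lt (Set.mem_ofPred_eq ▸ hx)
    · simpa using prob_le_one
  · refine le_of_forall_lt fun a ha => ?_
    have ha' : a ≠ ⊤ := ha.ne_top
    obtain ⟨q, hq1, hq2⟩ := exists_between ((ENNReal.lt_ofReal_iff_toReal_lt ha').1 ha)
    have hq0 : 0 ≤ q := ENNReal.toReal_nonneg.trans hq1.le
    calc a < ENNReal.ofReal q := (ENNReal.lt_ofReal_iff_toReal_lt ha').2 hq1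
      _ = ρ {x | ρ.real (Set.Iic x) ≤ q} := (measure_cdf_le ρ hq0 (hq2.trans_le h1)).symm
      _ ≤ _ := measure_mono fun x (hx : _ ≤ _) => lt_of_le_of_lt hx hq2

/-- The two-sided p-value of an atomless distribution is uniform. -/
theorem measure_two_mul_min_cdf_le (ρ : Measure ℝ) [IsProbabilityMeasure ρ]
    [NullSingletonClass ρ] {u : ℝ}
    (hu : u ∈ Set.Icc (0 : ℝ) 1) :
    ρ {x | 2 * min (ρ.real (Set.Iic x)) (1 - ρ.real (Set.Iic x)) ≤ u} = ENNReal.ofReal u := by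
  rcases hu.2.lt_or_eq with h1 | rfl
  · have hmeas : Measurable fun x => ρ.real (Set.Iic x) := by
      refine Monotone.measurable fun x y hxy => ?_
      exact measureReal_mono (Set.Iic_subset_Iic.2 hxy)
    -- Two tails of mass `u / 2` each, disjoint because `u < 1`.
    have hset : {x | 2 * min (ρ.real (Set.Iic x)) (1 - ρ.real (Set.Iic x)) ≤ u} =
        {x | ρ.real (Set.Iic x) ≤ u / 2} ∪ {x | ρ.real (Set.Iic x) < 1 - u / 2}ᶜ := by
      ext x
      simp only [Set.mem_ofPred_eq, Set.mem_union, Set.mem_compl_iff, not_lt]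
      rcases le_total (ρ.real (Set.Iic x)) (1 - ρ.real (Set.Iic x)) with h | h
      · rw [min_eq_left h]
        exact ⟨fun h' => Or.inl (by linarith), by rintro (h' | h') <;> linarith⟩
      · rw [min_eq_right h]
        exact ⟨fun h' => Or.inr (by linarith), by rintro (h' | h') <;> linarith⟩
    have hm2 : MeasurableSet {x | ρ.real (Set.Iic x) < 1 - u / 2} :=
      measurableSet_lt hmeas measurable_const
    rw [hset, measure_union _ hm2.compl, measure_cdf_le ρ (by linarith [hu.1]) (by linarith),
      prob_compl_eq_one_sub hm2, measure_cdf_lt ρ (by linarith) (by linarith [hu.1]),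
      ← ENNReal.ofReal_one, ← ENNReal.ofReal_sub _ (by linarith),
      ← ENNReal.ofReal_add (by linarith [hu.1]) (by linarith [hu.1])]
    · congr 1; ring
    · rw [Set.disjoint_compl_right_iff_subset]
      intro x hx
      simp only [Set.mem_ofPred_eq] at hx ⊢
      linarith
  · have : {x | 2 * min (ρ.real (Set.Iic x)) (1 - ρ.real (Set.Iic x)) ≤ 1} = Set.univ := by
      ext x
      simp only [Set.mem_ofPred_eq, Set.mem_univ, iff_true]
      rcases le_total (ρ.real (Set.Iic x)) (1 - ρ.real (Set.Iic x)) with h | h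
      · rw [min_eq_left h]; linarith
      · rw [min_eq_right h]; linarith
    rw [this]; simp

/-- The unnormalized form also covers `ν s = 0`, where both sides vanish; Fubini may meet such
fibres. -/
theorem measure_inter_two_mul_min_cond_le (ν : Measure ℝ) [IsFiniteMeasure ν]
    [NullSingletonClass ν]
    {s : Set ℝ} (hs : MeasurableSet s) {u : ℝ} (hu : u ∈ Set.Icc (0 : ℝ) 1) :
    ν (s ∩ {x | 2 * min ((cond ν s).real (Set.Iic x)) (1 - (cond ν s).real (Set.Iic x)) ≤ u}) =
      ENNReal.ofReal u * ν s := by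
  rcases eq_or_ne (ν s) 0 with h | h
  · rw [measure_inter_null_of_null_left _ h, h, mul_zero]
  · have := cond_isProbabilityMeasure h
    have : NullSingletonClass (cond ν s) := ⟨fun x => cond_absolutelyContinuous (measure_singleton x)⟩
    rw [← measure_two_mul_min_cdf_le (cond ν s) hu, cond_mul_eq_inter hs]

open scoped Matrix RealInnerProductSpace

/-! ### Independence of `Z(X)` and `ηᵀX` -/

section Gaussian

variable {n : ℕ} {μ : EuclideanSpace ℝ (Fin n)} {S : Matrix (Fin n) (Fin n) ℝ}

theorem inner_toLp_eq_dotProduct (a : Fin n → ℝ) (x : EuclideanSpace ℝ (Fin n)) :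
    ⟪WithLp.toLp 2 a, x⟫ = a ⬝ᵥ x.ofLp := by
  simp [PiLp.inner_apply, dotProduct, mul_comm]

theorem map_dotProduct_multivariateGaussian (hS : S.PosSemidef) (a : Fin n → ℝ) :
    (multivariateGaussian μ S).map (fun x => a ⬝ᵥ x.ofLp) =
      gaussianReal (a ⬝ᵥ μ.ofLp) (a ⬝ᵥ S *ᵥ a).toNNReal := by
  have h : (fun x : EuclideanSpace ℝ (Fin n) => a ⬝ᵥ x.ofLp) =
      innerSL ℝ (WithLp.toLp 2 a : EuclideanSpace ℝ (Fin n)) := by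
    ext x; rw [innerSL_apply_apply, inner_toLp_eq_dotProduct]
  rw [h, IsGaussian.map_eq_gaussianReal, ContinuousLinearMap.integral_comp_id_comm
    IsGaussian.integrable_id, integral_id_multivariateGaussian, innerSL_apply_apply,
    inner_toLp_eq_dotProduct]
  congr 2
  rw [← covariance_self (by fun_prop)]
  have h2 := covarianceBilin_multivariateGaussian (μ := μ) hS (WithLp.toLp 2 a) (WithLp.toLp 2 a)
  rw [covarianceBilin_apply_eq_cov IsGaussian.memLp_two_id] at h2
  exact h2

theorem dotProduct_mulVec_self_pos (hS : S.PosSemidef) (hSinv : IsUnit S) {a : Fin n → ℝ}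
    (ha : a ≠ 0) : 0 < a ⬝ᵥ S *ᵥ a := by
  have := (hS.posDef_iff_isUnit.2 hSinv).dotProduct_mulVec_pos ha
  simpa using this

/-- Hyperplanes are null sets of a nondegenerate Gaussian measure. -/
theorem multivariateGaussian_hyperplane (hS : S.PosSemidef) (hSinv : IsUnit S) {a : Fin n → ℝ}
    (ha : a ≠ 0) (r : ℝ) : multivariateGaussian μ S {x | a ⬝ᵥ x.ofLp = r} = 0 := by
  have hv : (a ⬝ᵥ S *ᵥ a).toNNReal ≠ 0 := by
    simpa using dotProduct_mulVec_self_pos hS hSinv ha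
  have := nullSingletonClass_gaussianReal (μ := a ⬝ᵥ μ.ofLp) hv
  have h := measure_singleton (μ := gaussianReal (a ⬝ᵥ μ.ofLp) (a ⬝ᵥ S *ᵥ a).toNNReal) r
  rw [← map_dotProduct_multivariateGaussian hS, Measure.map_apply (by fun_prop)
    (measurableSet_singleton r)] at h
  exact h

theorem zVec_eq (S : Matrix (Fin n) (Fin n) ℝ) (η x : Fin n → ℝ) :
    zVec S η x = x - (η ⬝ᵥ x) • cVec S η := by
  rw [zVec, Matrix.sub_mulVec, Matrix.one_mulVec, Matrix.vecMulVec_mulVec]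
  simp

/-- The left-hand side is the cross-covariance of `Z(X)` and `ηᵀX`; the choice of `c` is made to
cancel it. -/
theorem zVec_mulVec_self {η : Fin n → ℝ} (h : η ⬝ᵥ S *ᵥ η ≠ 0) : zVec S η (S *ᵥ η) = 0 := by
  rw [zVec_eq, cVec, smul_smul, mul_inv_cancel₀ h, one_smul, sub_self]

theorem measurable_zVec (S : Matrix (Fin n) (Fin n) ℝ) (η : Fin n → ℝ) :
    Measurable (zVec S η) := by
  have : zVec S η = fun x => x - (η ⬝ᵥ x) • cVec S η := funext (zVec_eq S η)
  rw [this]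
  fun_prop

/-- Both are linear images of one Gaussian vector, so they are jointly Gaussian and zero covariance
suffices. -/
theorem indepFun_zVec_dotProduct (hS : S.PosSemidef) {η : Fin n → ℝ} (h : η ⬝ᵥ S *ᵥ η ≠ 0) :
    IndepFun (fun x : EuclideanSpace ℝ (Fin n) => zVec S η x.ofLp) (fun x => η ⬝ᵥ x.ofLp)
      (multivariateGaussian μ S) := by
  set A : Matrix (Fin n) (Fin n) ℝ := 1 - Matrix.vecMulVec (cVec S η) η with hA
  let f : EuclideanSpace ℝ (Fin n) →L[ℝ] EuclideanSpace ℝ (Fin n) :=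
    Matrix.toEuclideanCLM (𝕜 := ℝ) A
  let g : EuclideanSpace ℝ (Fin n) →L[ℝ] ℝ := innerSL ℝ (WithLp.toLp 2 η)
  have hf : ∀ x, (f x).ofLp = zVec S η x.ofLp := fun x => by
    simp [f, zVec, hA, Matrix.sub_mulVec]
  have hg : ∀ x, g x = η ⬝ᵥ x.ofLp := fun x => by
    simp [g, inner_toLp_eq_dotProduct]
  have hG : HasGaussianLaw (fun x => (f x, g x)) (multivariateGaussian μ S) :=
    IsGaussian.hasGaussianLaw_id.map_fun (f.prod g)
  have hind : IndepFun f g (multivariateGaussian μ S) := by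
    refine hG.indepFun_of_covariance_inner fun a b => ?_
    -- Transposing `A` turns both maps into inner products with fixed vectors, whose covariance is
    -- read off `S`.
    have e1 : (fun x => ⟪a, f x⟫) =
        fun x => ⟪(WithLp.toLp 2 (Aᵀ *ᵥ a.ofLp) : EuclideanSpace ℝ (Fin n)), x⟫ := by
      ext x
      rw [inner_toLp_eq_dotProduct, inner_toLp_eq_dotProduct, Matrix.mulVec_transpose,
        ← Matrix.dotProduct_mulVec, hf]
      rfl
    have e2 : (fun x => ⟪b, g x⟫) =
        fun x => ⟪(WithLp.toLp 2 (b • η) : EuclideanSpace ℝ (Fin n)), x⟫ := by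
      ext x
      rw [inner_toLp_eq_dotProduct, hg]
      simp [mul_comm]
    rw [e1, e2, ← covarianceBilin_apply_eq_cov IsGaussian.memLp_two_id,
      covarianceBilin_multivariateGaussian hS]
    simp only [Matrix.mulVec_smul, dotProduct_smul]
    rw [Matrix.mulVec_transpose, ← Matrix.dotProduct_mulVec]
    have : A *ᵥ (S *ᵥ η) = 0 := zVec_mulVec_self h
    rw [this]; simp
  have hind' := hind.comp (φ := WithLp.ofLp) (ψ := id) (by fun_prop) measurable_id
  convert hind' using 1
  · ext x; simp [hf]
  · ext x; simp [hg]

theorem map_zVec_dotProduct (hS : S.PosSemidef) {η : Fin n → ℝ} (h : η ⬝ᵥ S *ᵥ η ≠ 0) :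
    (multivariateGaussian μ S).map (fun x => (zVec S η x.ofLp, η ⬝ᵥ x.ofLp)) =
      ((multivariateGaussian μ S).map (fun x => zVec S η x.ofLp)).prod
        (gaussianReal (η ⬝ᵥ μ.ofLp) (η ⬝ᵥ S *ᵥ η).toNNReal) := by
  have h1 : Measurable fun x : EuclideanSpace ℝ (Fin n) => zVec S η x.ofLp :=
    (measurable_zVec S η).comp (by fun_prop)
  rw [(indepFun_iff_map_prod_eq_prod_map_map h1.aemeasurable (by fun_prop)).1
    (indepFun_zVec_dotProduct hS h), map_dotProduct_multivariateGaussian hS]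

end Gaussian

/-! ### The polyhedral lemma and the p-value on the polyhedron -/

section Polyhedron

variable {n K : ℕ}

/-- The polyhedron `M P_σ x ≤ lam m`. -/
def polyhedron (lam : ℝ) (t : Fin (K + 1) → ℕ) (σ : Equiv.Perm (Fin n)) : Set (Fin n → ℝ) :=
  {x | ∀ r, ((matM n t * σ.permMatrix ℝ) *ᵥ x) r ≤ lam * vecM n t r}

/-- The truncation interval `[V⁻(z), V⁺(z)]`. -/
def truncInterval (lam : ℝ) (t : Fin (K + 1) → ℕ) (σ : Equiv.Perm (Fin n))
    (S : Matrix (Fin n) (Fin n) ℝ) (η z : Fin n → ℝ) : Set ℝ :=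
  {y | vMinus lam t σ S η z ≤ (y : EReal) ∧ (y : EReal) ≤ vPlus lam t σ S η z}

theorem mem_truncInterval_iff {lam : ℝ} {t : Fin (K + 1) → ℕ} {σ : Equiv.Perm (Fin n)}
    {S : Matrix (Fin n) (Fin n) ℝ} {η z : Fin n → ℝ} {y : ℝ} :
    y ∈ truncInterval lam t σ S η z ↔
      (∀ r, rowC t σ S η r < 0 → rowRatio lam t σ S η z r ≤ y) ∧
        ∀ r, 0 < rowC t σ S η r → y ≤ rowRatio lam t σ S η z r := by
  simp only [truncInterval, vMinus, vPlus, Set.mem_ofPred_eq, iSup_le_iff, le_iInf_iff,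
    EReal.coe_le_coe_iff]

/-- The polyhedral lemma. -/
theorem mem_polyhedron_iff {lam : ℝ} {t : Fin (K + 1) → ℕ} {σ : Equiv.Perm (Fin n)}
    {S : Matrix (Fin n) (Fin n) ℝ} {η x : Fin n → ℝ} :
    x ∈ polyhedron lam t σ ↔
      (∀ r, rowC t σ S η r = 0 →
        ((matM n t * σ.permMatrix ℝ) *ᵥ zVec S η x) r ≤ lam * vecM n t r) ∧
      η ⬝ᵥ x ∈ truncInterval lam t σ S η (zVec S η x) := by
  set A := matM n t * σ.permMatrix ℝ with hA
  -- For fixed `Z` each row is affine in `ηᵀx` with slope `rowC`: its sign makes the row a lower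
  -- bound, an upper bound, or a condition on `Z` only.
  have key : ∀ r, (A *ᵥ x) r = (A *ᵥ zVec S η x) r + (η ⬝ᵥ x) * rowC t σ S η r := by
    intro r
    have : x = zVec S η x + (η ⬝ᵥ x) • cVec S η := by rw [zVec_eq]; simp
    conv_lhs => rw [this]
    rw [Matrix.mulVec_add, Matrix.mulVec_smul]
    rfl
  rw [mem_truncInterval_iff]
  simp only [polyhedron, Set.mem_ofPred_eq, rowRatio, ← hA, key]
  constructor
  · intro h
    refine ⟨fun r hr => by simpa [hr] using h r, fun r hr => ?_, fun r hr => ?_⟩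
    · rw [div_le_iff_of_neg hr]; linarith [h r]
    · rw [le_div_iff₀ hr]; linarith [h r]
  · rintro ⟨h0, h1, h2⟩ r
    rcases lt_trichotomy (rowC t σ S η r) 0 with hr | hr | hr
    · have := h1 r hr
      rw [div_le_iff_of_neg hr] at this; linarith
    · simpa [hr] using h0 r hr
    · have := h2 r hr
      rw [le_div_iff₀ hr] at this; linarith

theorem measurableSet_forall {α ι : Type*} [MeasurableSpace α] [Countable ι] {p : ι → α → Prop}
    (h : ∀ i, MeasurableSet {x | p i x}) : MeasurableSet {x | ∀ i, p i x} := by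
  rw [Set.ofPred_forall]
  exact MeasurableSet.iInter h

variable (lam : ℝ) (t : Fin (K + 1) → ℕ) (σ : Equiv.Perm (Fin n)) (S : Matrix (Fin n) (Fin n) ℝ)
  (η : Fin n → ℝ)

theorem measurable_mulVec_apply {ι : Type*} (A : Matrix ι (Fin n) ℝ) (r : ι) :
    Measurable fun x : Fin n → ℝ => (A *ᵥ x) r := by
  simp only [Matrix.mulVec, dotProduct]
  fun_prop

theorem measurable_rowRatio (r : RowIndex n t) :
    Measurable fun z => rowRatio lam t σ S η z r :=
  (measurable_const.sub (measurable_mulVec_apply _ r)).div_const _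

theorem measurableSet_truncInterval :
    MeasurableSet {p : (Fin n → ℝ) × ℝ | p.2 ∈ truncInterval lam t σ S η p.1} := by
  simp only [mem_truncInterval_iff]
  have h := fun r => (measurable_rowRatio lam t σ S η r).comp
    (measurable_fst : Measurable (Prod.fst : (Fin n → ℝ) × ℝ → _))
  refine MeasurableSet.inter ?_ ?_
  · exact measurableSet_forall fun r => MeasurableSet.imp (.const _)
      (measurableSet_le (h r) measurable_snd)
  · exact measurableSet_forall fun r => MeasurableSet.imp (.const _)
      (measurableSet_le measurable_snd (h r))

theorem measurableSet_polyhedron : MeasurableSet (polyhedron lam t σ) :=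
  measurableSet_forall fun r => measurableSet_le (measurable_mulVec_apply _ r) measurable_const

/-- Joint measurability of the distribution function of a measure truncated to `[V⁻(z), V⁺(z)]`. -/
theorem measurable_cond_truncInterval (ν : Measure ℝ) [IsFiniteMeasure ν] :
    Measurable fun p : (Fin n → ℝ) × ℝ =>
      (cond ν (truncInterval lam t σ S η p.1)).real (Set.Iic p.2) := by
  have hI := measurableSet_truncInterval lam t σ S η
  have hI' : ∀ z, MeasurableSet (truncInterval lam t σ S η z) := fun z =>
    measurable_prodMk_left hI
  have h1 : Measurable fun p : (Fin n → ℝ) × ℝ => ν (truncInterval lam t σ S η p.1) :=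
    (measurable_measure_prodMk_left (ν := ν) hI).comp measurable_fst
  have h2 : Measurable fun p : (Fin n → ℝ) × ℝ =>
      ν (truncInterval lam t σ S η p.1 ∩ Set.Iic p.2) := by
    have : MeasurableSet {q : ((Fin n → ℝ) × ℝ) × ℝ |
        q.2 ∈ truncInterval lam t σ S η q.1.1 ∧ q.2 ≤ q.1.2} := by
      refine MeasurableSet.inter ?_ ?_
      · exact (measurable_fst.fst.prodMk measurable_snd :
          Measurable fun q : ((Fin n → ℝ) × ℝ) × ℝ => (q.1.1, q.2)) hI
      · exact measurableSet_le measurable_snd measurable_fst.snd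
    exact measurable_measure_prodMk_left (ν := ν) this
  -- The truncated distribution function is a ratio of section measures, each measurable in the
  -- parameters.
  simp only [Measure.real, cond_apply (hI' _)]
  exact (h1.inv.mul h2).ennreal_toReal

theorem measurable_pval : Measurable (pval lam t σ S η) := by
  have h : Measurable (tStat lam t σ S η) := by
    have h1 : Measurable fun x => (zVec S η x, η ⬝ᵥ x) :=
      (measurable_zVec S η).prodMk (by fun_prop)
    have h2 := (measurable_cond_truncInterval lam t σ S η
      (gaussianReal 0 (η ⬝ᵥ S *ᵥ η).toNNReal)).comp h1
    exact h2
  unfold pval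
  exact (h.min (measurable_const.sub h)).const_mul 2

/-- The probability of a small p-value on the polyhedron. -/
theorem measure_polyhedron_inter_pval_le {μ : EuclideanSpace ℝ (Fin n)} (hS : S.PosSemidef)
    (h : 0 < η ⬝ᵥ S *ᵥ η) (hημ : η ⬝ᵥ μ.ofLp = 0) {u : ℝ} (hu : u ∈ Set.Icc (0 : ℝ) 1) :
    multivariateGaussian μ S {x | x.ofLp ∈ polyhedron lam t σ ∧ pval lam t σ S η x.ofLp ≤ u} =
      ENNReal.ofReal u * multivariateGaussian μ S {x | x.ofLp ∈ polyhedron lam t σ} := by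
  set ν := gaussianReal 0 (η ⬝ᵥ S *ᵥ η).toNNReal with hν
  have : NullSingletonClass ν := nullSingletonClass_gaussianReal (by simpa using h)
  set ζ := (multivariateGaussian μ S).map (fun x => zVec S η x.ofLp) with hζ
  have hlaw := map_zVec_dotProduct (μ := μ) hS h.ne'
  -- The null hypothesis enters here: the law of `ηᵀX` is the centred Gaussian that `tStat`
  -- truncates.
  rw [hημ, ← hν, ← hζ] at hlaw
  have hmeas : Measurable fun x : EuclideanSpace ℝ (Fin n) => (zVec S η x.ofLp, η ⬝ᵥ x.ofLp) :=
    ((measurable_zVec S η).comp (by fun_prop)).prodMk (by fun_prop)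
  have : IsProbabilityMeasure ζ :=
    Measure.isProbabilityMeasure_map ((measurable_zVec S η).comp (by fun_prop)).aemeasurable
  set Z : Set (Fin n → ℝ) := {z | ∀ r, rowC t σ S η r = 0 →
    ((matM n t * σ.permMatrix ℝ) *ᵥ z) r ≤ lam * vecM n t r} with hZ
  have hZm : MeasurableSet Z := measurableSet_forall fun r => MeasurableSet.imp (.const _)
    (measurableSet_le (measurable_mulVec_apply _ r) measurable_const)
  let F : (Fin n → ℝ) × ℝ → ℝ := fun p =>
    (cond ν (truncInterval lam t σ S η p.1)).real (Set.Iic p.2)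
  have hF : Measurable F := measurable_cond_truncInterval lam t σ S η ν
  have hI := measurableSet_truncInterval lam t σ S η
  set Q : Set ((Fin n → ℝ) × ℝ) := {p | p.1 ∈ Z ∧ p.2 ∈ truncInterval lam t σ S η p.1} with hQ
  have hQm : MeasurableSet Q := (measurable_fst hZm).inter hI
  set R : Set ((Fin n → ℝ) × ℝ) := {p | 2 * min (F p) (1 - F p) ≤ u} with hR
  have hRm : MeasurableSet R :=
    measurableSet_le ((hF.min (measurable_const.sub hF)).const_mul 2) measurable_const
  have e1 : {x : EuclideanSpace ℝ (Fin n) | x.ofLp ∈ polyhedron lam t σ} =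
      (fun x : EuclideanSpace ℝ (Fin n) => (zVec S η x.ofLp, η ⬝ᵥ x.ofLp)) ⁻¹' Q := by
    ext x; exact mem_polyhedron_iff
  have e2 : {x : EuclideanSpace ℝ (Fin n) | x.ofLp ∈ polyhedron lam t σ ∧
      pval lam t σ S η x.ofLp ≤ u} =
      (fun x : EuclideanSpace ℝ (Fin n) => (zVec S η x.ofLp, η ⬝ᵥ x.ofLp)) ⁻¹' (Q ∩ R) := by
    ext x; exact and_congr mem_polyhedron_iff Iff.rfl
  -- Fubini for the product law of `(Z(X), ηᵀX)` reduces the claim to each fibre over `z`, which is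
  -- the truncation interval or empty.
  rw [e1, e2, ← Measure.map_apply hmeas hQm, ← Measure.map_apply hmeas (hQm.inter hRm), hlaw,
    Measure.prod_apply hQm, Measure.prod_apply (hQm.inter hRm),
    ← lintegral_const_mul _ (measurable_measure_prodMk_left hQm)]
  refine lintegral_congr fun z => ?_
  by_cases hz : z ∈ Z
  · have s1 : Prod.mk z ⁻¹' Q = truncInterval lam t σ S η z := by
      ext y; simp [hQ, hz]
    rw [Set.preimage_inter, s1]
    exact measure_inter_two_mul_min_cond_le ν (measurable_prodMk_left hI) hu
  · have s1 : Prod.mk z ⁻¹' Q = ∅ := by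
      ext y; simp [hQ, hz]
    rw [Set.preimage_inter, s1]; simp

end Polyhedron

/-! ### Partial sums and Abel summation -/

section PrefixSum

variable {n : ℕ}

/-- The sum of the first `l` coordinates of a vector. -/
noncomputable def prefixSum (f : Fin n → ℝ) (l : ℕ) : ℝ :=
  ∑ j : Fin n, if (j : ℕ) < l then f j else 0

theorem prefixSum_zero (f : Fin n → ℝ) : prefixSum f 0 = 0 := by
  simp [prefixSum]

theorem prefixSum_self (f : Fin n → ℝ) : prefixSum f n = ∑ j, f j := by
  simp [prefixSum]

theorem prefixSum_succ (f : Fin n → ℝ) {l : ℕ} (hl : l < n) :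
    prefixSum f (l + 1) = prefixSum f l + f ⟨l, hl⟩ := by
  have h : f ⟨l, hl⟩ = ∑ j : Fin n, if j = ⟨l, hl⟩ then f j else 0 := by simp
  rw [h, prefixSum, prefixSum, ← Finset.sum_add_distrib]
  refine Finset.sum_congr rfl fun j _ => ?_
  simp only [Fin.ext_iff]
  rcases lt_trichotomy (j : ℕ) l with hj | hj | hj
  · simp [hj, hj.ne, Nat.lt_succ_of_lt hj]
  · simp [hj]
  · simp [hj.ne', not_lt.2 hj.le, not_lt.2 (Nat.succ_le_of_lt hj)]

theorem prefixSum_add (f g : Fin n → ℝ) (l : ℕ) :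
    prefixSum (f + g) l = prefixSum f l + prefixSum g l := by
  simp only [prefixSum, ← Finset.sum_add_distrib]
  exact Finset.sum_congr rfl fun j _ => by split_ifs <;> simp

theorem prefixSum_sub (f g : Fin n → ℝ) (l : ℕ) :
    prefixSum (f - g) l = prefixSum f l - prefixSum g l := by
  simp only [prefixSum, ← Finset.sum_sub_distrib]
  exact Finset.sum_congr rfl fun j _ => by split_ifs <;> simp

theorem prefixSum_smul (c : ℝ) (f : Fin n → ℝ) (l : ℕ) :
    prefixSum (c • f) l = c * prefixSum f l := by
  simp only [prefixSum, Finset.mul_sum]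
  exact Finset.sum_congr rfl fun j _ => by split_ifs <;> simp

theorem sum_mul_indicator_lt (g : Fin n → ℝ) (l : ℕ) (ε : ℝ) :
    ∑ j : Fin n, g j * (if (j : ℕ) < l then ε else 0) = ε * prefixSum g l := by
  simp only [prefixSum, Finset.mul_sum]
  exact Finset.sum_congr rfl fun j _ => by split_ifs <;> ring

/-- Abel's inequality. -/
theorem sum_mul_nonneg_of_prefixSum_nonneg {g b : Fin n → ℝ} (hb : Antitone b)
    (hg : ∀ l ≤ n, 0 ≤ prefixSum g l) (hn : prefixSum g n = 0) : 0 ≤ ∑ j, g j * b j := by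
  rcases n with _ | m
  · simp
  -- Summation by parts: the discarded terms are a partial sum of `g` times a decrement of `b`, both
  -- non-negative.
  have key : ∀ l (hl : l < m + 1),
      prefixSum g (l + 1) * b ⟨l, hl⟩ ≤ prefixSum (fun j => g j * b j) (l + 1) := by
    intro l
    induction l with
    | zero => intro hl; simp [prefixSum_succ _ hl, prefixSum_zero]
    | succ l ih =>
      intro hl
      have h1 := ih (by omega)
      have h2 : b ⟨l + 1, hl⟩ ≤ b ⟨l, by omega⟩ := hb (by simp)
      have h3 := mul_le_mul_of_nonneg_left h2 (hg (l + 1) (by omega))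
      rw [prefixSum_succ _ hl, prefixSum_succ _ hl]
      linarith
  have h := key m (by omega)
  rwa [hn, zero_mul, prefixSum_self] at h

/-- Complementary slackness: in Abel's summation each partial sum of `g` multiplies a decrement of
`b`, and one of the two factors is zero. -/
theorem sum_mul_eq_zero_of_prefixSum {g b : Fin n → ℝ}
    (hg : ∀ (l : ℕ) (hl : l + 1 < n),
      prefixSum g (l + 1) = 0 ∨ b ⟨l, by omega⟩ = b ⟨l + 1, hl⟩)
    (hn : prefixSum g n = 0) : ∑ j, g j * b j = 0 := by
  rcases n with _ | m
  · simp
  have key : ∀ l (hl : l < m + 1),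
      prefixSum (fun j => g j * b j) (l + 1) = prefixSum g (l + 1) * b ⟨l, hl⟩ := by
    intro l
    induction l with
    | zero => intro hl; simp [prefixSum_succ _ hl, prefixSum_zero]
    | succ l ih =>
      intro hl
      have h1 := ih (by omega)
      rw [prefixSum_succ _ hl, prefixSum_succ g hl, h1]
      rcases hg l hl with h | h
      · rw [h]; ring
      · rw [h]; ring
  have h := key m (by omega)
  rwa [hn, zero_mul, prefixSum_self] at h

end PrefixSum

/-! ### Optimality conditions for sorted data -/

section Criterion

variable {n : ℕ}

/-- The coefficients of the fusion penalty on non-increasing vectors. -/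
def slope (n : ℕ) (j : Fin n) : ℝ := (n : ℝ) - 1 - 2 * j

theorem prefixSum_slope {l : ℕ} (hl : l ≤ n) : prefixSum (slope n) l = l * (n - l) := by
  induction l with
  | zero => simp [prefixSum_zero]
  | succ l ih =>
    rw [prefixSum_succ _ (by omega), ih (by omega), slope]
    push_cast; ring

/-- The sum over ordered pairs is visibly invariant under permutations. -/
theorem sum_Ioi_abs_sub (b : Fin n → ℝ) :
    ∑ i : Fin n, ∑ i' ∈ Finset.Ioi i, |b i' - b i| = 1 / 2 * ∑ i, ∑ j, |b i - b j| := by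
  have h := Finset.sum_sum_Ioi_add_eq_sum_sum_off_diag (fun i j : Fin n => |b i - b j|)
  have h1 : ∀ i : Fin n, ∑ j ∈ ({i}ᶜ : Finset (Fin n)), |b j - b i| = ∑ j, |b i - b j| := by
    intro i
    rw [← Finset.sum_compl_add_sum ({i} : Finset (Fin n)) (fun j => |b i - b j|)]
    simp [abs_sub_comm]
  simp only [h1] at h
  rw [← h, Finset.mul_sum]
  refine Finset.sum_congr rfl fun i _ => ?_
  rw [Finset.mul_sum]
  refine Finset.sum_congr rfl fun j _ => ?_
  rw [abs_sub_comm (b i) (b j)]; ring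

/-- The entry `b j` is the larger one in `n - 1 - j` pairs and the smaller one in `j` pairs. -/
theorem sum_Ioi_abs_sub_of_antitone {b : Fin n → ℝ} (hb : Antitone b) :
    ∑ i : Fin n, ∑ i' ∈ Finset.Ioi i, |b i' - b i| = ∑ j, slope n j * b j := by
  have h1 : ∀ i : Fin n, ∑ i' ∈ Finset.Ioi i, |b i' - b i| =
      ((n : ℝ) - 1 - i) * b i - ∑ i' ∈ Finset.Ioi i, b i' := by
    intro i
    have : ((n : ℝ) - 1 - i) = (Finset.Ioi i).card := by
      have := i.2
      rw [Fin.card_Ioi, Nat.cast_sub (by omega), Nat.cast_sub (by omega)]; simp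
    rw [this, ← nsmul_eq_mul, ← Finset.sum_const, ← Finset.sum_sub_distrib]
    refine Finset.sum_congr rfl fun j hj => ?_
    rw [abs_sub_comm, abs_of_nonneg (sub_nonneg.2 (hb (Finset.mem_Ioi.1 hj).le))]
  have h2 : ∑ i : Fin n, ∑ i' ∈ Finset.Ioi i, b i' = ∑ i' : Fin n, (i' : ℝ) * b i' := by
    rw [Finset.sum_comm' (t' := Finset.univ) (s' := fun j => Finset.Iio j) (by simp)]
    refine Finset.sum_congr rfl fun j _ => ?_
    simp
  simp only [h1, Finset.sum_sub_distrib, h2]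
  rw [← Finset.sum_sub_distrib]
  refine Finset.sum_congr rfl fun j _ => ?_
  rw [slope]; ring

/-- The criterion as a function of plain vectors. -/
noncomputable def vecCriterion (lam : ℝ) (y b : Fin n → ℝ) : ℝ :=
  1 / 2 * ∑ j, (b j - y j) ^ 2 + lam * ∑ i : Fin n, ∑ i' ∈ Finset.Ioi i, |b i' - b i|

theorem vecCriterion_comp_perm (lam : ℝ) (y b : Fin n → ℝ) (σ : Equiv.Perm (Fin n)) :
    vecCriterion lam (y ∘ σ) (b ∘ σ) = vecCriterion lam y b := by
  simp only [vecCriterion, sum_Ioi_abs_sub, Function.comp_apply]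
  rw [Equiv.sum_comp σ (fun j => (b j - y j) ^ 2),
    Equiv.sum_comp σ (fun i => ∑ j, |b i - b (σ j)|)]
  congr 3
  refine Finset.sum_congr rfl fun i _ => Equiv.sum_comp σ (fun j => |b i - b j|)

theorem criterion_eq_vecCriterion (lam : ℝ) (x B : EuclideanSpace ℝ (Fin n)) :
    criterion lam x B = vecCriterion lam x.ofLp B.ofLp := by
  simp [criterion, vecCriterion, EuclideanSpace.norm_sq_eq]

theorem isSolution_iff (lam : ℝ) (x B : EuclideanSpace ℝ (Fin n)) (σ : Equiv.Perm (Fin n)) :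
    IsSolution lam x B ↔
      ∀ b, vecCriterion lam (x.ofLp ∘ σ) (B.ofLp ∘ σ) ≤ vecCriterion lam (x.ofLp ∘ σ) b := by
  simp only [IsSolution, criterion_eq_vecCriterion]
  constructor
  · intro h b
    have h1 := h (WithLp.toLp 2 (b ∘ σ.symm))
    have h2 : b = (b ∘ σ.symm) ∘ σ := by ext j; simp
    rw [h2, vecCriterion_comp_perm, vecCriterion_comp_perm]
    exact h1
  · intro h B'
    rw [← vecCriterion_comp_perm lam _ _ σ, ← vecCriterion_comp_perm lam _ B'.ofLp σ]
    exact h _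

/-- The gradient at `b` of the criterion among non-increasing vectors. -/
noncomputable def grad (lam : ℝ) (y b : Fin n → ℝ) : Fin n → ℝ := b - y + lam • slope n

/-- The criterion is quadratic on the cone of non-increasing vectors, so its second-order expansion
is exact. -/
theorem vecCriterion_sub {lam : ℝ} {y b c : Fin n → ℝ} (hb : Antitone b) (hc : Antitone c) :
    vecCriterion lam y c - vecCriterion lam y b =
      1 / 2 * ∑ j, (c j - b j) ^ 2 + ∑ j, grad lam y b j * (c j - b j) := by
  simp only [vecCriterion, sum_Ioi_abs_sub_of_antitone hb, sum_Ioi_abs_sub_of_antitone hc,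
    Finset.mul_sum, ← Finset.sum_add_distrib, ← Finset.sum_sub_distrib]
  refine Finset.sum_congr rfl fun j _ => ?_
  simp only [grad, Pi.add_apply, Pi.sub_apply, Pi.smul_apply, smul_eq_mul]
  ring

theorem exists_perm_antitone (b : Fin n → ℝ) : ∃ τ : Equiv.Perm (Fin n), Antitone (b ∘ τ) := by
  refine ⟨Tuple.sort (fun i => -b i), fun i j hij => ?_⟩
  have := Tuple.monotone_sort (fun i => -b i) hij
  simpa using this

/-- Sorting decreases the criterion if the data are sorted. -/
theorem vecCriterion_comp_le {lam : ℝ} {y b : Fin n → ℝ} (hy : Antitone y)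
    {τ : Equiv.Perm (Fin n)} (hτ : Antitone (b ∘ τ)) :
    vecCriterion lam y (b ∘ τ) ≤ vecCriterion lam y b := by
  rw [← vecCriterion_comp_perm lam y b τ]
  -- Penalty and sums of squares ignore the order; only the cross term changes, and the
  -- rearrangement inequality controls it.
  have hm : Monovary y (b ∘ τ) := hy.monovary hτ
  have h := hm.sum_mul_comp_perm_le_sum_mul (σ := τ⁻¹)
  have h2 : ∑ i, y i * (b ∘ τ) (τ⁻¹ i) = ∑ j, y (τ j) * b (τ j) := by
    rw [Equiv.sum_comp τ (fun j => y j * b j)]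
    simp
  rw [h2] at h
  have h3 := Equiv.sum_comp τ (fun j => y j ^ 2)
  have e : ∀ y' : Fin n → ℝ, ∑ j, ((b ∘ τ) j - y' j) ^ 2 =
      ∑ j, b (τ j) ^ 2 - 2 * ∑ j, y' j * b (τ j) + ∑ j, y' j ^ 2 := by
    intro y'
    rw [Finset.mul_sum, ← Finset.sum_sub_distrib, ← Finset.sum_add_distrib]
    refine Finset.sum_congr rfl fun j _ => ?_
    simp only [Function.comp_apply]; ring
  unfold vecCriterion
  rw [e, e]
  simp only [Function.comp_apply] at h ⊢
  linarith

/-- Sufficiency of the optimality conditions. Once the competitor is sorted, its pairing with the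
gradient is non-negative by Abel's inequality, while that of `b` is zero by slackness. -/
theorem vecCriterion_le_of_prefixSum {lam : ℝ} {y b : Fin n → ℝ} (hy : Antitone y)
    (hb : Antitone b) (hg : ∀ l ≤ n, 0 ≤ prefixSum (grad lam y b) l)
    (hn : prefixSum (grad lam y b) n = 0)
    (hj : ∀ (l : ℕ) (hl : l + 1 < n),
      prefixSum (grad lam y b) (l + 1) = 0 ∨ b ⟨l, by omega⟩ = b ⟨l + 1, hl⟩)
    (c : Fin n → ℝ) : vecCriterion lam y b ≤ vecCriterion lam y c := by
  obtain ⟨τ, hτ⟩ := exists_perm_antitone c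
  refine le_trans ?_ (vecCriterion_comp_le hy hτ)
  rw [← sub_nonneg, vecCriterion_sub hb hτ]
  simp only [mul_sub, Finset.sum_sub_distrib]
  rw [sum_mul_eq_zero_of_prefixSum hj hn]
  have := sum_mul_nonneg_of_prefixSum_nonneg hτ hg hn
  have : 0 ≤ ∑ j, ((c ∘ τ) j - b j) ^ 2 := Finset.sum_nonneg fun j _ => sq_nonneg _
  linarith

/-- The segment from `b` to `c` stays in the cone, so the derivative at `b` along it cannot be
negative. -/
theorem sum_grad_mul_sub_nonneg {lam : ℝ} {y b c : Fin n → ℝ} (hb : Antitone b)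
    (hc : Antitone c) (hmin : ∀ c, vecCriterion lam y b ≤ vecCriterion lam y c) :
    0 ≤ ∑ j, grad lam y b j * (c j - b j) := by
  set Q := ∑ j, (c j - b j) ^ 2 with hQ
  set L := ∑ j, grad lam y b j * (c j - b j) with hL
  have hQ0 : 0 ≤ Q := Finset.sum_nonneg fun j _ => sq_nonneg _
  have key : ∀ ε : ℝ, 0 ≤ ε → ε ≤ 1 → 0 ≤ 1 / 2 * (ε ^ 2 * Q) + ε * L := by
    intro ε h0 h1
    have hanti : Antitone fun j => b j + ε * (c j - b j) := fun i j hij => by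
      have := hb hij; have := hc hij
      nlinarith
    have h := hmin fun j => b j + ε * (c j - b j)
    rw [← sub_nonneg, vecCriterion_sub hb hanti] at h
    convert h using 2
    · rw [hQ, Finset.mul_sum]
      congr 1; exact Finset.sum_congr rfl fun j _ => by ring
    · rw [hL, Finset.mul_sum]
      exact Finset.sum_congr rfl fun j _ => by ring
  by_contra hneg
  push Not at hneg
  have hpos : 0 < Q + 1 - L := by linarith
  -- This `ε` lies in `(0, 1)` and gives `ε Q + L = -ε (1 - L) < 0`, contradicting `key`.
  have h := key (-L / (Q + 1 - L)) (div_nonneg (by linarith) hpos.le)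
    ((div_le_one hpos).2 (by linarith))
  set ε := -L / (Q + 1 - L) with hε
  have hε0 : 0 < ε := div_pos (by linarith) hpos
  have h2 : ε * (Q + 1 - L) = -L := div_mul_cancel₀ _ hpos.ne'
  nlinarith

/-- Raising the first `l` entries keeps the vector non-increasing, so it is an admissible direction.
-/
theorem prefixSum_grad_nonneg {lam : ℝ} {y b : Fin n → ℝ} (hb : Antitone b)
    (hmin : ∀ c, vecCriterion lam y b ≤ vecCriterion lam y c) (l : ℕ) :
    0 ≤ prefixSum (grad lam y b) l := by
  have hc : Antitone fun j : Fin n => b j + if (j : ℕ) < l then (1 : ℝ) else 0 := by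
    intro i j hij
    have h1 := hb hij
    have h2 : (i : ℕ) ≤ j := hij
    dsimp only
    split_ifs <;> linarith
  have h := sum_grad_mul_sub_nonneg hb hc hmin
  simpa only [add_sub_cancel_left, sum_mul_indicator_lt, one_mul] using h

/-- At a strict drop the first `l` entries can also be lowered slightly, which gives the reverse
inequality. -/
theorem prefixSum_grad_eq_zero {lam : ℝ} {y b : Fin n → ℝ} (hb : Antitone b)
    (hmin : ∀ c, vecCriterion lam y b ≤ vecCriterion lam y c) {l : ℕ}
    (hl : ∀ i j : Fin n, (i : ℕ) < l → l ≤ j → b j < b i) :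
    prefixSum (grad lam y b) l = 0 := by
  refine le_antisymm ?_ (prefixSum_grad_nonneg hb hmin l)
  -- `δ` is the smallest gap across the cut, or `1` if no pair of positions straddles it.
  obtain ⟨δ, hδ, hgap⟩ : ∃ δ : ℝ, 0 < δ ∧
      ∀ i j : Fin n, (i : ℕ) < l → l ≤ j → b j + δ ≤ b i := by
    let s : Finset (Fin n × Fin n) := Finset.univ.filter fun p => (p.1 : ℕ) < l ∧ l ≤ p.2
    rcases s.eq_empty_or_nonempty with hs | hs
    · refine ⟨1, one_pos, fun i j hi hj => absurd (?_ : (i, j) ∈ s) (by simp [hs])⟩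
      simp [s, hi, hj]
    · obtain ⟨p, hp, hmin'⟩ := s.exists_min_image (fun p => b p.1 - b p.2) hs
      simp only [s, Finset.mem_filter, Finset.mem_univ, true_and, Prod.forall] at hp hmin'
      refine ⟨b p.1 - b p.2, sub_pos.2 (hl _ _ hp.1 hp.2), fun i j hi hj => ?_⟩
      have := hmin' i j ⟨hi, hj⟩
      linarith
  have hc : Antitone fun j : Fin n => b j + if (j : ℕ) < l then -δ else 0 := by
    intro i j hij
    have h1 := hb hij
    have h2 : (i : ℕ) ≤ j := hij
    have h3 := hgap i j
    dsimp only
    split_ifs with h4 h5 h5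
    · linarith
    · omega
    · have := h3 h5 (by omega); linarith
    · linarith
  have h := sum_grad_mul_sub_nonneg hb hc hmin
  simp only [add_sub_cancel_left, sum_mul_indicator_lt] at h
  by_contra hneg
  push Not at hneg
  nlinarith

theorem prefixSum_grad {lam : ℝ} {y b : Fin n → ℝ} {l : ℕ} (hl : l ≤ n) :
    prefixSum (grad lam y b) l = prefixSum b l - prefixSum y l + lam * (l * (n - l)) := by
  rw [grad, prefixSum_add, prefixSum_sub, prefixSum_smul, prefixSum_slope hl]

end Criterion

/-! ### Block structure and the selection event -/

section Blocks

variable {n K : ℕ} {t : Fin (K + 1) → ℕ}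

theorem exists_block (ht : t ∈ rightLimits K n) {j : ℕ} (hj : j < n) :
    ∃ k : Fin K, t k.castSucc ≤ j ∧ j < t k.succ := by
  by_contra hcon
  push Not at hcon
  have h : ∀ k : Fin (K + 1), t k ≤ j := by
    intro k
    induction k using Fin.induction with
    | zero => rw [ht.1]; exact Nat.zero_le j
    | succ k ih => exact hcon k ih
  have := h (Fin.last K)
  rw [ht.2.2] at this
  omega

/-- The cluster of a position of the sorted data. -/
noncomputable def blockOf (ht : t ∈ rightLimits K n) (j : Fin n) : Fin K :=
  (exists_block ht j.2).choose

theorem blockOf_spec (ht : t ∈ rightLimits K n) (j : Fin n) :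
    t (blockOf ht j).castSucc ≤ j ∧ (j : ℕ) < t (blockOf ht j).succ :=
  (exists_block ht j.2).choose_spec

theorem le_of_block (ht : t ∈ rightLimits K n) {i j : ℕ} {k k' : Fin K}
    (hi : t k.castSucc ≤ i) (hj : j < t k'.succ) (hij : i ≤ j) : k ≤ k' := by
  have h := ht.2.1.lt_iff_lt.1 (show t k.castSucc < t k'.succ by omega)
  rw [Fin.lt_def] at h
  simp only [Fin.val_castSucc, Fin.val_succ] at h
  exact Fin.le_def.2 (by omega)

theorem blockOf_eq_iff (ht : t ∈ rightLimits K n) (j : Fin n) (k : Fin K) :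
    blockOf ht j = k ↔ t k.castSucc ≤ j ∧ (j : ℕ) < t k.succ := by
  constructor
  · rintro rfl; exact blockOf_spec ht j
  · rintro ⟨h1, h2⟩
    have h := blockOf_spec ht j
    exact le_antisymm (le_of_block ht h.1 h2 le_rfl) (le_of_block ht h1 h.2 le_rfl)

theorem monotone_blockOf (ht : t ∈ rightLimits K n) : Monotone (blockOf ht) := fun i j hij =>
  le_of_block ht (blockOf_spec ht i).1 (blockOf_spec ht j).2 hij

theorem castSucc_lt_succ (ht : t ∈ rightLimits K n) (k : Fin K) : t k.castSucc < t k.succ :=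
  ht.2.1 Fin.castSucc_lt_succ

theorem rightLimit_le (ht : t ∈ rightLimits K n) (k : Fin (K + 1)) : t k ≤ n := by
  rw [← ht.2.2]; exact ht.2.1.monotone (Fin.le_last k)

theorem mem_segClustering_iff (ht : t ∈ rightLimits K n) (σ : Equiv.Perm (Fin n)) (k : Fin K)
    (j : Fin n) : σ j ∈ segClustering t σ k ↔ blockOf ht j = k := by
  rw [blockOf_eq_iff]
  simp [segClustering]

theorem prefixSum_block (ht : t ∈ rightLimits K n) (v : Fin K → ℝ) (k : Fin K) {l : ℕ}
    (hl : t k.castSucc + l ≤ t k.succ) :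
    prefixSum (v ∘ blockOf ht) (t k.castSucc + l) =
      prefixSum (v ∘ blockOf ht) (t k.castSucc) + l * v k := by
  have hn := rightLimit_le ht k.succ
  induction l with
  | zero => simp
  | succ l ih =>
    rw [← add_assoc, prefixSum_succ _ (by omega), ih (by omega)]
    have : blockOf ht ⟨t k.castSucc + l, by omega⟩ = k :=
      (blockOf_eq_iff ht _ k).2 ⟨by simp, by simp; omega⟩
    simp only [Function.comp_apply, this]
    push_cast; ring

/-- The value of the solution on the cluster `k`, for sorted data `y`. -/
noncomputable def clusterValue (lam : ℝ) (t : Fin (K + 1) → ℕ) (y : Fin n → ℝ) (k : Fin K) : ℝ :=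
  (prefixSum y (t k.succ) - prefixSum y (t k.castSucc)) / ((t k.succ : ℝ) - t k.castSucc) -
    lam * (n - t k.castSucc - t k.succ)

theorem prefixSum_grad_block (ht : t ∈ rightLimits K n) {lam : ℝ} {y : Fin n → ℝ}
    (v : Fin K → ℝ) (k : Fin K) {l : ℕ} (hl : t k.castSucc + l ≤ t k.succ) :
    prefixSum (grad lam y (v ∘ blockOf ht)) (t k.castSucc + l) =
      prefixSum (grad lam y (v ∘ blockOf ht)) (t k.castSucc) + l * v k -
        (prefixSum y (t k.castSucc + l) - prefixSum y (t k.castSucc)) +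
        lam * (l * (n - 2 * t k.castSucc - l)) := by
  have hn := rightLimit_le ht k.succ
  rw [prefixSum_grad (by omega), prefixSum_grad (by omega), prefixSum_block ht v k hl]
  push_cast; ring

/-- The gradient sums to zero over a block exactly when the value there is `clusterValue`; this is
what identifies the solution. -/
theorem prefixSum_grad_succ (ht : t ∈ rightLimits K n) {lam : ℝ} {y : Fin n → ℝ}
    (v : Fin K → ℝ) (k : Fin K) :
    prefixSum (grad lam y (v ∘ blockOf ht)) (t k.succ) =
      prefixSum (grad lam y (v ∘ blockOf ht)) (t k.castSucc) +
        ((t k.succ : ℝ) - t k.castSucc) * (v k - clusterValue lam t y k) := by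
  have h := castSucc_lt_succ ht k
  obtain ⟨l, hl⟩ := Nat.exists_eq_add_of_lt h
  have h1 := prefixSum_grad_block ht (lam := lam) (y := y) v k (l := l + 1) (by omega)
  rw [← add_assoc, ← hl] at h1
  have h2 : (t k.succ : ℝ) = t k.castSucc + (l + 1) := by rw [hl]; push_cast; ring
  have h3 : ((l : ℝ) + 1) ≠ 0 := by positivity
  rw [h1, clusterValue, h2]
  push_cast
  field_simp
  ring

/-- The description of the selection event by inequalities on the sorted data. -/
theorem mem_selectionSet_iff (ht : t ∈ rightLimits K n) {lam : ℝ} (hlam : 0 < lam)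
    (σ : Equiv.Perm (Fin n)) (x : EuclideanSpace ℝ (Fin n)) :
    x ∈ selectionSet lam t σ ↔ Antitone (x.ofLp ∘ σ) ∧
      StrictAnti (clusterValue lam t (x.ofLp ∘ σ)) ∧
      ∀ (k : Fin K) (l : ℕ), 0 < l → t k.castSucc + l < t k.succ →
        (prefixSum (x.ofLp ∘ σ) (t k.castSucc + l) - prefixSum (x.ofLp ∘ σ) (t k.castSucc)) / l -
          (prefixSum (x.ofLp ∘ σ) (t k.succ) - prefixSum (x.ofLp ∘ σ) (t k.castSucc)) /
            ((t k.succ : ℝ) - t k.castSucc) ≤ lam * (((t k.succ : ℝ) - t k.castSucc) - l) := by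
  set y := x.ofLp ∘ σ with hy
  -- When the partial sum of the gradient vanishes at the start of the block, the third family of
  -- inequalities is its non-negativity inside the block, divided by `l`.
  have key : ∀ (k : Fin K) (l : ℕ), 0 < l → t k.castSucc + l < t k.succ →
      prefixSum (grad lam y (clusterValue lam t y ∘ blockOf ht)) (t k.castSucc) = 0 →
      ((prefixSum y (t k.castSucc + l) - prefixSum y (t k.castSucc)) / l -
        (prefixSum y (t k.succ) - prefixSum y (t k.castSucc)) /
          ((t k.succ : ℝ) - t k.castSucc) ≤ lam * (((t k.succ : ℝ) - t k.castSucc) - l) ↔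
      0 ≤ prefixSum (grad lam y (clusterValue lam t y ∘ blockOf ht)) (t k.castSucc + l)) := by
    intro k l hl0 hl h0
    have hl' : (0 : ℝ) < l := by exact_mod_cast hl0
    rw [prefixSum_grad_block ht _ k hl.le, h0, clusterValue]
    generalize (prefixSum y (t k.succ) - prefixSum y (t k.castSucc)) /
          ((t k.succ : ℝ) - t k.castSucc) = m
    rw [sub_le_iff_le_add, div_le_iff₀ hl']
    constructor <;> intro h <;> linarith
  constructor
  · rintro ⟨⟨v, hv, -, hC⟩, hanti⟩
    have hb : (bHat lam x).ofLp ∘ σ = v ∘ blockOf ht := by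
      ext j
      exact (hC _ _).1 ((mem_segClustering_iff ht σ _ j).2 rfl)
    have hmin := (isSolution_iff lam x _ σ).1 (bHat_isSolution hlam x)
    rw [hb, ← hy] at hmin
    have hbanti : Antitone (v ∘ blockOf ht) := hv.antitone.comp_monotone (monotone_blockOf ht)
    -- Positions on the two sides of `t k` lie in different blocks, so the solution drops strictly
    -- there.
    have hzero : ∀ k, prefixSum (grad lam y (v ∘ blockOf ht)) (t k) = 0 := by
      intro k
      refine prefixSum_grad_eq_zero hbanti hmin fun i j hi hj => hv ?_
      refine lt_of_le_of_ne (monotone_blockOf ht (Fin.le_def.2 (by omega))) fun heq => ?_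
      have h1 := (blockOf_spec ht i).1
      have h2 := (blockOf_spec ht j).2
      rw [heq] at h1
      have h3 := ht.2.1.lt_iff_lt.1 (h1.trans_lt hi)
      have h4 := ht.2.1.lt_iff_lt.1 (hj.trans_lt h2)
      rw [Fin.lt_def] at h3 h4
      simp only [Fin.val_castSucc, Fin.val_succ] at h3 h4
      omega
    have hval : clusterValue lam t y = v := by
      ext k
      have h := prefixSum_grad_succ ht (lam := lam) (y := y) v k
      rw [hzero, hzero, zero_add] at h
      have h2 : (0 : ℝ) < (t k.succ : ℝ) - t k.castSucc :=
        sub_pos.2 (by exact_mod_cast castSucc_lt_succ ht k)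
      have := (mul_eq_zero.1 h.symm).resolve_left h2.ne'
      linarith
    refine ⟨hanti, hval ▸ hv, fun k l hl0 hl => ?_⟩
    rw [key k l hl0 hl (by rw [hval]; exact hzero _), hval]
    exact prefixSum_grad_nonneg hbanti hmin _
  · rintro ⟨hanti, hv, h3⟩
    set v := clusterValue lam t y with hvdef
    have hbanti : Antitone (v ∘ blockOf ht) := hv.antitone.comp_monotone (monotone_blockOf ht)
    have hzero : ∀ k, prefixSum (grad lam y (v ∘ blockOf ht)) (t k) = 0 := by
      intro k
      induction k using Fin.induction with
      | zero => rw [ht.1, prefixSum_zero]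
      | succ k ih => rw [prefixSum_grad_succ ht, ih, ← hvdef]; ring
    have hn : prefixSum (grad lam y (v ∘ blockOf ht)) n = 0 := by
      have := hzero (Fin.last K)
      rwa [ht.2.2] at this
    -- The blockwise constant candidate satisfies the sufficient conditions; uniqueness then
    -- identifies it with `bHat`.
    have hsol : IsSolution lam x (WithLp.toLp 2 ((v ∘ blockOf ht) ∘ σ.symm)) := by
      rw [isSolution_iff lam x _ σ]
      have e : ((v ∘ blockOf ht) ∘ σ.symm) ∘ σ = v ∘ blockOf ht := by ext j; simp
      change ∀ b, vecCriterion lam y (((v ∘ blockOf ht) ∘ σ.symm) ∘ σ) ≤ vecCriterion lam y b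
      rw [e]
      refine vecCriterion_le_of_prefixSum hanti hbanti (fun l hl => ?_) hn fun l hl => ?_
      · rcases hl.lt_or_eq with hl | rfl
        · obtain ⟨k, hk1, hk2⟩ := exists_block ht hl
          obtain ⟨i, rfl⟩ := Nat.exists_eq_add_of_le hk1
          rcases Nat.eq_zero_or_pos i with rfl | hi
          · exact (hzero k.castSucc).ge
          · exact (key k i hi hk2 (hzero _)).1 (h3 k i hi hk2)
        · exact hn.ge
      · by_cases hb : blockOf ht ⟨l, by omega⟩ = blockOf ht ⟨l + 1, hl⟩
        · right; simp [hb]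
        · left
          have h1 := blockOf_spec ht ⟨l, by omega⟩
          -- If the block changes between `l` and `l + 1`, then `l + 1` is a right-limit, where the
          -- partial sum is zero.
          have h2 : ¬ l + 1 < t (blockOf ht ⟨l, by omega⟩).succ := fun h =>
            hb ((blockOf_eq_iff ht ⟨l + 1, hl⟩ _).2 ⟨h1.1.trans (by simp), h⟩).symm
          have h4 : l + 1 = t (blockOf ht ⟨l, by omega⟩).succ := by
            have := h1.2
            simp only at this
            omega
          rw [h4]; exact hzero _
    have hB : bHat lam x = WithLp.toLp 2 ((v ∘ blockOf ht) ∘ σ.symm) :=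
      isSolution_unique hlam (bHat_isSolution hlam x) hsol
    refine ⟨⟨v, hv, ?_, fun k i => ?_⟩, hanti⟩
    · rw [hB]
      have hsurj : Function.Surjective (blockOf ht ∘ σ.symm) := by
        refine Function.Surjective.comp (fun k => ?_) σ.symm.surjective
        have h1 := castSucc_lt_succ ht k
        have h2 := rightLimit_le ht k.succ
        exact ⟨⟨t k.castSucc, by omega⟩, (blockOf_eq_iff ht _ k).2 ⟨le_rfl, h1⟩⟩
      exact (hsurj.range_comp v).symm
    · obtain ⟨j, rfl⟩ := σ.surjective i
      rw [mem_segClustering_iff ht, hB]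
      simp [hv.injective.eq_iff]

end Blocks

/-! ### The rows of `M` and the exceptional faces -/

section Rows

variable {n K : ℕ} {t : Fin (K + 1) → ℕ}

theorem M₁_mulVec (y : Fin n → ℝ) (i : Fin (n - 1)) :
    (M₁ n *ᵥ y) i = y ⟨i + 1, by omega⟩ - y ⟨i, by omega⟩ := by
  have h1 : y ⟨i + 1, by omega⟩ =
      ∑ j : Fin n, if j = ⟨i + 1, by omega⟩ then y j else 0 := by simp
  have h2 : y ⟨i, by omega⟩ = ∑ j : Fin n, if j = ⟨i, by omega⟩ then y j else 0 := by simp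
  rw [h1, h2, ← Finset.sum_sub_distrib]
  simp only [Matrix.mulVec, dotProduct]
  refine Finset.sum_congr rfl fun j _ => ?_
  simp only [M₁, Matrix.of_apply, Fin.ext_iff]
  split_ifs <;> first | omega | ring

theorem M₂_mulVec (y : Fin n → ℝ) (k : Fin (K - 1)) (ht : Monotone t) :
    (M₂ n t *ᵥ y) k =
      (prefixSum y (t ⟨k + 2, by omega⟩) - prefixSum y (t ⟨k + 1, by omega⟩)) /
          ((t ⟨k + 2, by omega⟩ : ℝ) - t ⟨k + 1, by omega⟩) -
        (prefixSum y (t ⟨k + 1, by omega⟩) - prefixSum y (t ⟨k, by omega⟩)) /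
          ((t ⟨k + 1, by omega⟩ : ℝ) - t ⟨k, by omega⟩) := by
  have h01 : t ⟨k, by omega⟩ ≤ t ⟨k + 1, by omega⟩ := ht (Fin.le_def.2 (by simp))
  have h12 : t ⟨k + 1, by omega⟩ ≤ t ⟨k + 2, by omega⟩ := ht (Fin.le_def.2 (by simp))
  simp only [prefixSum, ← Finset.sum_sub_distrib, Finset.sum_div]
  simp only [Matrix.mulVec, dotProduct]
  refine Finset.sum_congr rfl fun j _ => ?_
  simp only [M₂, Matrix.of_apply]
  split_ifs <;> first | omega | ring

theorem M₃_mulVec (y : Fin n → ℝ) (r : Σ k : Fin K, Fin (clusterSize t k - 1))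
    (ht : Monotone t) :
    (M₃ n t *ᵥ y) r =
      (prefixSum y (t r.1.castSucc + (r.2 + 1)) - prefixSum y (t r.1.castSucc)) /
          ((r.2 : ℝ) + 1) -
        (prefixSum y (t r.1.succ) - prefixSum y (t r.1.castSucc)) / (clusterSize t r.1 : ℝ) := by
  have h01 : t r.1.castSucc ≤ t r.1.succ := ht Fin.castSucc_lt_succ.le
  simp only [prefixSum, ← Finset.sum_sub_distrib, Finset.sum_div]
  simp only [Matrix.mulVec, dotProduct]
  refine Finset.sum_congr rfl fun j _ => ?_
  simp only [M₃, Matrix.of_apply]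
  split_ifs <;> first | omega | ring

theorem mem_polyhedron_iff_rows {lam : ℝ} {σ : Equiv.Perm (Fin n)} {x : Fin n → ℝ} :
    x ∈ polyhedron lam t σ ↔ (∀ i, (M₁ n *ᵥ (x ∘ σ)) i ≤ 0) ∧
      (∀ k, (M₂ n t *ᵥ (x ∘ σ)) k ≤ lam * m₂ t k) ∧
      ∀ r, (M₃ n t *ᵥ (x ∘ σ)) r ≤ lam * m₃ t r := by
  simp only [polyhedron, Set.mem_ofPred_eq, ← Matrix.mulVec_mulVec, Matrix.permMatrix_mulVec,
    matM, Matrix.fromRows_mulVec, vecM, Sum.forall, Sum.elim_inl, Sum.elim_inr, mul_zero]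

theorem antitone_iff_M₁_mulVec (y : Fin n → ℝ) :
    Antitone y ↔ ∀ i, (M₁ n *ᵥ y) i ≤ 0 := by
  rcases n with _ | m
  · exact ⟨fun _ i => i.elim0, fun _ i => i.elim0⟩
  · rw [Fin.antitone_iff_succ_le]
    simp only [M₁_mulVec, sub_nonpos]
    rfl

/-- In the difference of consecutive values the shifts leave `lam * (t (k + 2) - t k)`. Distinct
clusters need strict inequality, unlike the polyhedron. -/
theorem strictAnti_clusterValue_iff (ht : t ∈ rightLimits K n) (lam : ℝ) (y : Fin n → ℝ) :
    StrictAnti (clusterValue lam t y) ↔ ∀ k, (M₂ n t *ᵥ y) k < lam * m₂ t k := by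
  rcases K with _ | K
  · exact ⟨fun _ i => i.elim0, fun _ i => i.elim0⟩
  · rw [Fin.strictAnti_iff_succ_lt]
    refine forall_congr' fun k => ?_
    rw [M₂_mulVec (K := K + 1) y k ht.2.1.monotone]
    have e0 : (⟨(k : ℕ), by omega⟩ : Fin (K + 2)) = k.castSucc.castSucc := rfl
    have e1 : (⟨(k : ℕ) + 1, by omega⟩ : Fin (K + 2)) = k.castSucc.succ := rfl
    have e1' : k.succ.castSucc = k.castSucc.succ := rfl
    have e2 : (⟨(k : ℕ) + 2, by omega⟩ : Fin (K + 2)) = k.succ.succ := rfl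
    simp only [clusterValue, m₂, e0, e1, e1', e2]
    constructor <;> intro h <;> linarith

theorem forall_prefix_iff_M₃_mulVec (ht : t ∈ rightLimits K n) (lam : ℝ) (y : Fin n → ℝ) :
    (∀ (k : Fin K) (l : ℕ), 0 < l → t k.castSucc + l < t k.succ →
        (prefixSum y (t k.castSucc + l) - prefixSum y (t k.castSucc)) / l -
          (prefixSum y (t k.succ) - prefixSum y (t k.castSucc)) /
            ((t k.succ : ℝ) - t k.castSucc) ≤ lam * (((t k.succ : ℝ) - t k.castSucc) - l)) ↔
      ∀ r, (M₃ n t *ᵥ y) r ≤ lam * m₃ t r := by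
  have hsize : ∀ k : Fin K, (clusterSize t k : ℝ) = (t k.succ : ℝ) - t k.castSucc := fun k => by
    rw [clusterSize, Nat.cast_sub (castSucc_lt_succ ht k).le]
  simp only [M₃_mulVec y _ ht.2.1.monotone, m₃, hsize]
  constructor
  · rintro h ⟨k, l⟩
    have hl := l.2
    unfold clusterSize at hl
    have := h k (l + 1) (Nat.succ_pos _) (by omega)
    push_cast at this
    exact this
  · intro h k l hl0 hl
    obtain ⟨i, rfl⟩ := Nat.exists_eq_add_of_lt hl0
    have := h ⟨k, ⟨i, by unfold clusterSize; omega⟩⟩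
    simp only [zero_add] at this ⊢
    push_cast
    exact this

/-- The selection event is the polyhedron without some of its faces. -/
theorem mem_selectionSet_iff_mem_polyhedron (ht : t ∈ rightLimits K n) {lam : ℝ} (hlam : 0 < lam)
    (σ : Equiv.Perm (Fin n)) (x : EuclideanSpace ℝ (Fin n)) :
    x ∈ selectionSet lam t σ ↔ x.ofLp ∈ polyhedron lam t σ ∧
      ∀ k, (M₂ n t *ᵥ (x.ofLp ∘ σ)) k ≠ lam * m₂ t k := by
  rw [mem_selectionSet_iff ht hlam, mem_polyhedron_iff_rows, antitone_iff_M₁_mulVec,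
    strictAnti_clusterValue_iff ht, forall_prefix_iff_M₃_mulVec ht]
  simp only [lt_iff_le_and_ne, forall_and]
  tauto

theorem M₂_row_ne_zero (ht : t ∈ rightLimits K n) (k : Fin (K - 1)) : M₂ n t k ≠ 0 := by
  intro h
  have h01 : t ⟨k, by omega⟩ < t ⟨k + 1, by omega⟩ := ht.2.1 (Fin.lt_def.2 (by simp))
  have hn := rightLimit_le ht ⟨k + 1, by omega⟩
  have h1 := congrFun h ⟨t ⟨k, by omega⟩, by omega⟩
  simp only [M₂, Matrix.of_apply, le_refl, h01, and_self, if_true, Pi.zero_apply, neg_eq_zero,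
    one_div, inv_eq_zero, sub_eq_zero, Nat.cast_inj] at h1
  omega

/-- The missing faces lie in finitely many hyperplanes with non-zero normals, null because `S` is
invertible. -/
theorem selectionSet_ae_eq_polyhedron (ht : t ∈ rightLimits K n) {lam : ℝ} (hlam : 0 < lam)
    (σ : Equiv.Perm (Fin n)) {μ : EuclideanSpace ℝ (Fin n)} {S : Matrix (Fin n) (Fin n) ℝ}
    (hS : S.PosSemidef) (hSinv : IsUnit S) :
    (selectionSet lam t σ : Set (EuclideanSpace ℝ (Fin n))) =ᵐ[multivariateGaussian μ S]
      {x | x.ofLp ∈ polyhedron lam t σ} := by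
  have h : ∀ᵐ x ∂(multivariateGaussian μ S),
      ∀ k, (M₂ n t *ᵥ (x.ofLp ∘ σ)) k ≠ lam * m₂ t k := by
    rw [ae_all_iff]
    intro k
    -- The normal vector of the face in the unsorted coordinates.
    have hne : (fun i => M₂ n t k (σ.symm i)) ≠ 0 := fun h0 => M₂_row_ne_zero ht k <| by
      ext j
      simpa using congrFun h0 (σ j)
    have h0 := multivariateGaussian_hyperplane (μ := μ) hS hSinv hne (lam * m₂ t k)
    rw [ae_iff]
    refine measure_mono_null (fun x hx => ?_) h0
    simp only [ne_eq, not_not, Set.mem_ofPred_eq] at hx ⊢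
    rw [← hx]
    simp only [Matrix.mulVec, dotProduct]
    rw [← Equiv.sum_comp σ]
    simp
  filter_upwards [h] with x hx
  exact propext ((mem_selectionSet_iff_mem_polyhedron ht hlam σ x).trans (and_iff_left hx))

end Rows

/-! ### Conclusion: the conditional law -/

theorem isUniform_Icc_of_forall_measure_le {Ω : Type*} [MeasurableSpace Ω] {P : Measure Ω}
    [IsProbabilityMeasure P] {p : Ω → ℝ} (hp : AEMeasurable p P)
    (h : ∀ u ∈ Set.Icc (0 : ℝ) 1, P {ω | p ω ≤ u} = ENNReal.ofReal u) :
    pdf.IsUniform p (Set.Icc 0 1) P volume := by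
  have hvol : cond (volume : Measure ℝ) (Set.Icc 0 1) = volume.restrict (Set.Icc 0 1) := by
    simp [ProbabilityTheory.cond]
  rw [pdf.IsUniform, hvol]
  have : IsProbabilityMeasure (P.map p) := Measure.isProbabilityMeasure_map hp
  refine Measure.ext_of_Iic _ _ fun u => ?_
  rw [Measure.map_apply_of_aemeasurable hp measurableSet_Iic,
    Measure.restrict_apply measurableSet_Iic]
  change P {ω | p ω ≤ u} = _
  -- The values at `0` and `1` settle every `u` outside `[0, 1]` by monotonicity.
  have h0 := h 0 (by simp)
  have h1 := h 1 (by simp)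
  rcases lt_or_ge u 0 with hu | hu
  · have e : Set.Iic u ∩ Set.Icc (0 : ℝ) 1 = ∅ := by
      ext y; simp; intro h1 h2; linarith
    rw [e, measure_empty]
    refine measure_mono_null (fun ω hω => ?_) (h0.trans (by simp))
    simp only [Set.mem_ofPred_eq] at hω ⊢
    linarith
  · rcases le_or_gt u 1 with hu1 | hu1
    · have e : Set.Iic u ∩ Set.Icc (0 : ℝ) 1 = Set.Icc 0 u := by
        ext y; simp; constructor
        · rintro ⟨a, b, c⟩; exact ⟨b, a⟩
        · rintro ⟨a, b⟩; exact ⟨b, a, b.trans hu1⟩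
      rw [e, h u ⟨hu, hu1⟩, Real.volume_Icc, sub_zero]
    · have e : Set.Iic u ∩ Set.Icc (0 : ℝ) 1 = Set.Icc 0 1 :=
        Set.inter_eq_right.2 fun y hy => hy.2.trans hu1.le
      rw [e, Real.volume_Icc, sub_zero, ENNReal.ofReal_one]
      refine le_antisymm prob_le_one ?_
      rw [← ENNReal.ofReal_one, ← h1]
      refine measure_mono fun ω hω => ?_
      simp only [Set.mem_ofPred_eq] at hω ⊢
      linarith

end ConvexClustering

theorem mainTheorem3 {Ω : Type*} [MeasurableSpace Ω] (P : Measure Ω) [IsProbabilityMeasure P]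
    (n K : ℕ) (hK : K ∈ Finset.Icc 1 n)
    (t : Fin (K + 1) → ℕ) (ht : t ∈ ConvexClustering.rightLimits K n)
    (σ : Equiv.Perm (Fin n))
    (μ : EuclideanSpace ℝ (Fin n)) (S : Matrix (Fin n) (Fin n) ℝ)
    (hS : S.PosSemidef) (hSinv : IsUnit S)
    (X : Ω → EuclideanSpace ℝ (Fin n)) (hX : HasLaw X (multivariateGaussian μ S) P)
    (η : Fin n → ℝ) (hη : η ≠ 0) (hημ : η ⬝ᵥ μ.ofLp = 0)
    (lam : ℝ) (hlam : 0 < lam)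
    (hE : P (X ⁻¹' ConvexClustering.selectionSet lam t σ) ≠ 0) :
    pdf.IsUniform (fun ω => ConvexClustering.pval lam t σ S η (X ω).ofLp) (Set.Icc 0 1)
        (cond P (X ⁻¹' ConvexClustering.selectionSet lam t σ)) volume ∧
      ∀ u ∈ Set.Icc (0 : ℝ) 1,
        cond P (X ⁻¹' ConvexClustering.selectionSet lam t σ)
          {ω | ConvexClustering.pval lam t σ S η (X ω).ofLp ≤ u} = ENNReal.ofReal u := by
  set E : Set (EuclideanSpace ℝ (Fin n)) := ConvexClustering.selectionSet lam t σ with hEdef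
  set G := multivariateGaussian μ S with hG
  have hae : E =ᵐ[G] {x | x.ofLp ∈ ConvexClustering.polyhedron lam t σ} :=
    ConvexClustering.selectionSet_ae_eq_polyhedron ht hlam σ hS hSinv
  have hpolym : MeasurableSet {x : EuclideanSpace ℝ (Fin n) |
      x.ofLp ∈ ConvexClustering.polyhedron lam t σ} :=
    (WithLp.measurable_ofLp 2 (Fin n → ℝ))
      (ConvexClustering.measurableSet_polyhedron lam t σ)
  -- Null-measurability of the selection event, inherited from the polyhedron, is enough for
  -- conditioning on it.
  have hEm : NullMeasurableSet E (P.map X) := by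
    rw [hX.map_eq]
    exact hpolym.nullMeasurableSet.congr hae.symm
  have hpm : Measurable fun x : EuclideanSpace ℝ (Fin n) =>
      ConvexClustering.pval lam t σ S η x.ofLp :=
    (ConvexClustering.measurable_pval lam t σ S η).comp (WithLp.measurable_ofLp 2 (Fin n → ℝ))
  have hPE : NullMeasurableSet (X ⁻¹' E) P := by
    refine (hX.aemeasurable.nullMeasurableSet_preimage hpolym).congr ?_
    rw [← hX.map_eq] at hae
    filter_upwards [ae_of_ae_map hX.aemeasurable hae] with ω hω using hω.symm
  have : IsProbabilityMeasure (cond P (X ⁻¹' E)) := cond_isProbabilityMeasure hE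
  have hcdf : ∀ u ∈ Set.Icc (0 : ℝ) 1, cond P (X ⁻¹' E)
      {ω | ConvexClustering.pval lam t σ S η (X ω).ofLp ≤ u} = ENNReal.ofReal u := by
    intro u hu
    have hum := measurableSet_le hpm (measurable_const (a := u))
    have h1 : P (X ⁻¹' E) = G {x | x.ofLp ∈ ConvexClustering.polyhedron lam t σ} := by
      rw [← measure_congr hae, ← hX.map_eq, Measure.map_apply₀ hX.aemeasurable hEm]
    have h2 : P ({ω | ConvexClustering.pval lam t σ S η (X ω).ofLp ≤ u} ∩ X ⁻¹' E) =
        ENNReal.ofReal u * P (X ⁻¹' E) := by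
      rw [h1, ← ConvexClustering.measure_polyhedron_inter_pval_le lam t σ S η hS
        (ConvexClustering.dotProduct_mulVec_self_pos hS hSinv hη) hημ hu]
      have e : {ω | ConvexClustering.pval lam t σ S η (X ω).ofLp ≤ u} ∩ X ⁻¹' E =
          X ⁻¹' (E ∩ {x | ConvexClustering.pval lam t σ S η x.ofLp ≤ u}) := by
        ext ω; exact and_comm
      rw [e, ← Measure.map_apply₀ hX.aemeasurable (hEm.inter hum.nullMeasurableSet), hX.map_eq]
      exact measure_congr (hae.inter (ae_eq_refl _))
    rw [ProbabilityTheory.cond, Measure.smul_apply, Measure.restrict_apply₀' hPE, h2, smul_eq_mul, mul_comm,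
      mul_assoc, ENNReal.mul_inv_cancel hE (measure_ne_top _ _), mul_one]
  refine ⟨ConvexClustering.isUniform_Icc_of_forall_measure_le ?_ hcdf, hcdf⟩
  exact hpm.comp_aemeasurable (hX.aemeasurable.mono_ac cond_absolutelyContinuous)
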